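/- Let $K,J\in\mathbb N$. A fluid network $(\alpha,\mu,P,C)$ consists of vectors $\alpha,\mu\in\mathbb R_+^K$ (inflow and outflow rates), a substochastic $K\times K$ matrix $P$ (nonnegative entries, row sums at most one) of spectral radius strictly less than one, and the $J\times K$ matrix $C$ with $c_{jk}=1$ if $s(k)=j$ and $c_{jk}=0$ otherwise, where $s:\{1,\dots,K\}\to\{1,\dots,J\}$ assigns to each fluid class the station serving it. Put $M=\operatorname{diag}(\mu)$, $e=(1,\dots,1)^T$ and $\|x\|=\sum_k|x_k|$. The set $\mathcal Q_C$ of fluid level processes of the (general) work-conserving network is the set of all $Q:\mathbb R_+\to\mathbb R_+^K$ for which there is a function $T:\mathbb R_+\to\mathbb R^K$ such that, with $I(t):=et-C\,T(t)$, $$Q(t)=Q(0)+\alpha t-(I_K-P^T)M\,T(t)\ge 0\quad(t\ge0),$$ $T(0)=0$, $T$ and $I$ are nondecreasing in every component, and $$\int_0^\infty (C\,Q(t))^T\,dI(t)=0 .$$ **Theorem.** The set $\mathcal Q=\mathcal Q_C$ of fluid level processes of every such network is a strict GFN model, that is, it is nonempty and (a) there is $L>0$ with $\|Q(t)-Q(s)\|\le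 L|t-s|$ for all $Q\in\mathcal Q$ and $s,t\ge0$; (b) $Q\in\mathcal Q$ implies $\frac1r Q(r\,\cdot)\in\mathcal Q$ for all $r>0$; (c) $Q\in\mathcal Q$ implies $Q(s+\cdot)\in\mathcal Q$ for all $s\ge0$; (d) if $Q_n\in\mathcal Q$ converges to $Q_*:\mathbb R_+\to\mathbb R_+^K$ uniformly on compact sets, then $Q_*\in\mathcal Q$; (e) (concatenation property) if $Q_1,Q_2\in\mathcal Q$, $t^*\ge0$ and $Q_1(t^*)=Q_2(0)$, then the path that equals $Q_1(t)$ for $t\le t^*$ and $Q_2(t-t^*)$ for $t\ge t^*$ belongs to $\mathcal Q$; (f) (lower semicontinuity property) there is $T>0$ such that the set-valued map $x\rightsquigarrow\{Q|_{[0,T]}:Q\in\mathcal Q,\ Q(0)=x\}$ is lower semicontinuous: whenever $Q\in\mathcal Q$, $Q(0)=x$ and $x_n\to x$, where each $x_n$ is the initial value of some element of $\mathcal Q$, there are $Q_n\in\mathcal Q$ with $Q_n(0)=x_n$ and $Q_n\to Q$ uniformly on $[0,T]$. Moreover, every $x\in\mathbb R_+^K$ is the initial value $Q(0)$ of some $Q\in\mathcal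 Q$. Consequently, the network is stable, i.e. there is $\tau>0$ with $Q(\tau+t)=0$ for all $t\ge0$ and all $Q\in\mathcal Q$ with $\|Q(0)\|=1$, if and only if it admits a continuous Lyapunov function, i.e. a continuous $V:\mathbb R_+^K\to\mathbb R_+$ for which there are continuous, strictly increasing $w_1,w_2,w_3:\mathbb R_+\to\mathbb R_+$ with $w_i(0)=0$ such that $$w_1(\|x\|)\le V(x)\le w_2(\|x\|)\quad(x\in\mathbb R_+^K),$$ $$V(Q(t))-V(Q(s))\le-\int_s^t w_3(\|Q(r)\|)\,dr\quad(0\le s\le t,\ Q\in\mathcal Q).$$ -/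

import Mathlib

open Filter Topology MeasureTheory
open scoped NNReal ENNReal Matrix

noncomputable section

namespace FluidNet

/-- The nonnegative orthant `ℝ₊^K`. -/
abbrev Orthant (K : ℕ) : Type := Fin K → ℝ≥0

/-- Functions `ℝ₊ → ℝ₊^K`. -/
abbrev Path (K : ℕ) : Type := ℝ≥0 → Orthant K

/-- The norm `‖x‖ = ∑ₖ |xₖ|` of a vector of the nonnegative orthant. -/
def l1 {K : ℕ} (x : Orthant K) : ℝ≥0 := ∑ k, x k

/-- The distance `‖x - y‖ = ∑ₖ |xₖ - yₖ|` between two vectors of the nonnegative orthant. -/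
def l1Dist {K : ℕ} (x y : Orthant K) : ℝ := ∑ k, |(x k : ℝ) - (y k : ℝ)|

/-- Uniform convergence on compact sets (u.o.c.) of a sequence of paths. -/
def TendstoUOC {K : ℕ} (Qs : ℕ → Path K) (Q : Path K) : Prop :=
  ∀ T : ℝ≥0, 0 < T → TendstoUniformlyOn Qs Q atTop (Set.Icc 0 T)

/-- GFN models: nonempty, uniformly Lipschitz, closed under scaling and under shifts. -/
structure IsGFN {K : ℕ} (Φ : Set (Path K)) : Prop where
  nonempty : Φ.Nonempty
  lipschitz : ∃ L : ℝ, 0 < L ∧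
    ∀ Q ∈ Φ, ∀ t s : ℝ≥0, l1Dist (Q t) (Q s) ≤ L * |(t : ℝ) - (s : ℝ)|
  scaling : ∀ Q ∈ Φ, ∀ r : ℝ≥0, 0 < r → (fun t => r⁻¹ • Q (r * t)) ∈ Φ
  shift : ∀ Q ∈ Φ, ∀ s : ℝ≥0, (fun t => Q (s + t)) ∈ Φ

/-- Closed GFN models. -/
structure IsClosedGFN {K : ℕ} (Φ : Set (Path K)) : Prop extends IsGFN Φ where
  closed : ∀ (Qs : ℕ → Path K) (Q : Path K), (∀ n, Qs n ∈ Φ) → TendstoUOC Qs Q → Q ∈ Φ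

/-- The concatenation of `Q₁` and `Q₂` at time `tstar`. -/
def concat {K : ℕ} (Q₁ : Path K) (tstar : ℝ≥0) (Q₂ : Path K) : Path K :=
  fun t => if t ≤ tstar then Q₁ t else Q₂ (t - tstar)

/-- The concatenation property. -/
def HasConcatenation {K : ℕ} (Φ : Set (Path K)) : Prop :=
  ∀ Q₁ ∈ Φ, ∀ Q₂ ∈ Φ, ∀ tstar : ℝ≥0, Q₁ tstar = Q₂ 0 → concat Q₁ tstar Q₂ ∈ Φ

/-- Lower semicontinuity of a set-valued map `F : X ⇝ Y` (at every point of its domain, along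
sequences in its domain). -/
def SetValuedLSC {X Y : Type*} [TopologicalSpace X] [TopologicalSpace Y] (F : X → Set Y) : Prop :=
  ∀ x : X, ∀ y ∈ F x, ∀ xs : ℕ → X, (∀ n, (F (xs n)).Nonempty) → Tendsto xs atTop (𝓝 x) →
    ∃ ys : ℕ → Y, (∀ n, ys n ∈ F (xs n)) ∧ Tendsto ys atTop (𝓝 y)

/-- The restriction of a path to `[0,T]`, as an element of the space of functions on `[0,T]` with
the topology of uniform convergence. -/
def restrictPath {K : ℕ} (T : ℝ≥0) (Q : Path K) :
    UniformFun (Set.Icc (0 : ℝ≥0) T) (Orthant K) :=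
  UniformFun.ofFun (fun t : Set.Icc (0 : ℝ≥0) T => Q t)

/-- The set `Φ_x` of the paths with initial value `x`. -/
def pathsFrom {K : ℕ} (Φ : Set (Path K)) (x : Orthant K) : Set (Path K) := {Q ∈ Φ | Q 0 = x}

/-- The lower semicontinuity property: for some `T > 0` the set-valued map that sends `x` to the
set of the restrictions to `[0,T]` of the paths starting at `x` is lower semicontinuous. -/
def HasLSC {K : ℕ} (Φ : Set (Path K)) : Prop :=
  ∃ T : ℝ≥0, 0 < T ∧ SetValuedLSC (fun x : Orthant K => restrictPath T '' pathsFrom Φ x)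

/-- Strict GFN models. -/
structure IsStrictGFN {K : ℕ} (Φ : Set (Path K)) : Prop extends IsClosedGFN Φ where
  concatenation : HasConcatenation Φ
  lsc : HasLSC Φ

/-- Stability: every path with initial level one vanishes beyond a common time `τ`. -/
def IsStable {K : ℕ} (Φ : Set (Path K)) : Prop :=
  ∃ τ : ℝ≥0, 0 < τ ∧ ∀ Q ∈ Φ, l1 (Q 0) = 1 → ∀ t : ℝ≥0, Q (τ + t) = 0

/-- The set `𝒜(Φ)` of the initial states of the paths of `Φ`. -/
def initialStates {K : ℕ} (Φ : Set (Path K)) : Set (Orthant K) := {x | ∃ Q ∈ Φ, Q 0 = x}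

/-- Comparison functions of class `𝒦`. -/
structure IsClassK (w : ℝ≥0 → ℝ≥0) : Prop where
  continuous : Continuous w
  strictMono : StrictMono w
  zero : w 0 = 0

/-- Lyapunov functions on `𝒜(Φ)`; the values of `V` outside `𝒜(Φ)` play no role when `Φ` is a GFN
model, because `𝒜(Φ)` then contains every value of every path. The paths of a GFN model are
continuous, so that the integrand below is continuous. -/
def IsLyapunov {K : ℕ} (Φ : Set (Path K)) (V : Orthant K → ℝ≥0) : Prop :=
  ∃ w₁ w₂ w₃ : ℝ≥0 → ℝ≥0, IsClassK w₁ ∧ IsClassK w₂ ∧ IsClassK w₃ ∧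
    (∀ x ∈ initialStates Φ, w₁ (l1 x) ≤ V x ∧ V x ≤ w₂ (l1 x)) ∧
    (∀ Q ∈ Φ, ∀ s t : ℝ≥0, s ≤ t →
      (V (Q t) : ℝ) - (V (Q s) : ℝ) ≤
        -∫ r in (s : ℝ)..(t : ℝ), (w₃ (l1 (Q r.toNNReal)) : ℝ))

/-- The data `(α, μ, P, C)` of a fluid network with `K` fluid classes and `J` stations; the
constituency matrix `C` is given by the map that sends a class to the station serving it. -/
structure Network (K J : ℕ) where
  /-- exogenous inflow rates -/
  α : Orthant K
  /-- potential outflow rates -/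
  μ : Orthant K
  /-- routing matrix -/
  P : Matrix (Fin K) (Fin K) ℝ
  /-- the station at which a class is served -/
  station : Fin K → Fin J
  P_nonneg : ∀ k l, 0 ≤ P k l
  P_row_sum_le_one : ∀ k, ∑ l, P k l ≤ 1
  P_spectralRadius_lt_one : spectralRadius ℂ (P.map (algebraMap ℝ ℂ)) < 1

namespace Network

variable {K J : ℕ} (N : Network K J)

/-- The constituency matrix. -/
def C : Matrix (Fin J) (Fin K) ℝ := Matrix.of fun j k => if N.station k = j then 1 else 0

/-- The diagonal matrix of the outflow rates. -/
def M : Matrix (Fin K) (Fin K) ℝ := Matrix.diagonal fun k => (N.μ k : ℝ)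

/-- The unused capacity process `I(t) = e t - C T(t)` of an allocation process `T`. -/
def idle (T : ℝ≥0 → Fin K → ℝ) (j : Fin J) (t : ℝ≥0) : ℝ := (t : ℝ) - (N.C *ᵥ T t) j

/-- The amounts of fluid `C Q(t)` at the stations. -/
def stationLevel (Q : Path K) (t : ℝ≥0) (j : Fin J) : ℝ :=
  (N.C *ᵥ fun k => (Q t k : ℝ)) j

/-- Fluid solutions `(Q, T)` under a general work-conserving discipline. The inequality `Q ≥ 0` is
part of the type of `Q`. The integral `∫₀^∞ (C Q(t))ᵀ dI(t)` is the sum over the stations of the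
integrals of the nonnegative functions `(C Q)ⱼ` against the Lebesgue–Stieltjes measures `dIⱼ` on
`ℝ₊`. -/
structure IsFluidSolution (Q : Path K) (T : ℝ≥0 → Fin K → ℝ) : Prop where
  flow_balance : ∀ (t : ℝ≥0) (k : Fin K),
    (Q t k : ℝ) = (Q 0 k : ℝ) + (N.α k : ℝ) * (t : ℝ) - (((1 - N.Pᵀ) * N.M) *ᵥ T t) k
  alloc_zero : T 0 = 0
  alloc_mono : Monotone T
  idle_mono : ∀ j, Monotone (N.idle T j)
  work_conserving :
    ∑ j, ∫⁻ t, ENNReal.ofReal (N.stationLevel Q t j) ∂(idle_mono j).stieltjesFunction.measure = 0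

/-- The set `𝒬_C` of the fluid level processes of the work-conserving fluid network. -/
def fluidLevels : Set (Path K) := {Q | ∃ T : ℝ≥0 → Fin K → ℝ, N.IsFluidSolution Q T}

end Network

end FluidNet

end

open Filter Topology MeasureTheory
open scoped NNReal ENNReal Matrix

/-! ### Work conservation as a local condition -/

namespace FluidNet

/-! Levels and idle processes are Lipschitz, so the integral condition says that each idle process
is locally constant wherever its station is nonempty (`isFluidSolution_iff`). This local form is
compatible with scaling, shifts and concatenation. Since all levels share one Lipschitz constant, a
station that is nonempty in the limit is nonempty on a fixed neighbourhood along the approximations,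
so the condition also survives pointwise limits (`mem_fluidLevels_of_tendsto`). Existence follows
from a discrete scheme by the same limit argument (`exists_allocation`).

The central point is `exists_ge_mem_fluidLevels`. Given `Q` and `y ≥ Q 0`, let the surplus `y - Q 0`
be served, without inflow, by the capacity that `Q` leaves idle. This is why allocations are built
for arbitrary capacities of rate at most one. The sum of the two solutions is a work-conserving
process from `y` which dominates `Q`, and the surplus never grows because routing creates no fluid.
For lower semicontinuity, shrink `Q` by a factor `r` near one with `r • Q 0 ≤ xₙ`, then add the
missing surplus.

For a stable network the Lyapunov function is `maxContent`, the supremum of `∫ ‖Q(t)‖ dt` over the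
paths from `x`. Concatenation gives the decrease with `w₃ = id`; the Lipschitz bound and the
extinction time give quadratic bounds. Domination and scaling give its lower semicontinuity,
compactness of the paths its upper semicontinuity. Conversely, a Lyapunov function forces the level
to halve within a time proportional to it (`exists_halving_time`), and the halving times form a
convergent geometric series. -/

/-- The positive part of a continuous function has integral zero against the Stieltjes measure of a
continuous monotone function `f` iff `f` is locally constant where the function is positive. -/
theorem lintegral_stieltjes_eq_zero_iff {f : ℝ≥0 → ℝ} (hf : Monotone f) (hc : Continuous f)
    {g : ℝ≥0 → ℝ} (hg : Continuous g) :
    ∫⁻ t, ENNReal.ofReal (g t) ∂hf.stieltjesFunction.measure = 0 ↔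
      ∀ u, 0 < g u → ∀ᶠ a in 𝓝 u, f a = f u := by
  have hval : ∀ x, hf.stieltjesFunction x = f x := fun x =>
    (hf.stieltjesFunction_eq x).trans hc.continuousAt.continuousWithinAt.rightLim_eq
  have hfun : (hf.stieltjesFunction : ℝ≥0 → ℝ) = f := funext hval
  have hIcc : ∀ a b, hf.stieltjesFunction.measure (Set.Icc a b) = ENNReal.ofReal (f b - f a) := by
    intro a b
    rw [StieltjesFunction.measure_Icc, hfun, hc.continuousAt.continuousWithinAt.leftLim_eq]
  -- Order intervals are the sets whose measure is an explicit increment of `f`; truncated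
  -- subtraction lets one construction cover points near `0` as well.
  have hnhds : ∀ u : ℝ≥0, ∀ s ∈ 𝓝 u, ∃ a b, a ≤ u ∧ u ≤ b ∧ Set.Icc a b ∈ 𝓝 u ∧
      Set.Icc a b ⊆ s := by
    intro u s hs
    obtain ⟨ε, hε, h⟩ := Metric.mem_nhds_iff.1 hs
    obtain ⟨δ, hδ⟩ : ∃ δ : ℝ≥0, (δ : ℝ) = ε / 2 := ⟨⟨ε / 2, by positivity⟩, rfl⟩
    have hδ0 : (0 : ℝ) < δ := by rw [hδ]; positivity
    refine ⟨u - δ, u + δ, tsub_le_self, le_self_add, ?_, ?_⟩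
    · refine Filter.mem_of_superset (Metric.ball_mem_nhds u hδ0) fun x hx => ?_
      rw [Metric.mem_ball, NNReal.dist_eq, abs_lt] at hx
      constructor
      · rw [tsub_le_iff_right, ← NNReal.coe_le_coe]; push_cast; linarith
      · rw [← NNReal.coe_le_coe]; push_cast; linarith
    · intro x hx
      apply h
      have h1 := hx.1
      have h2 := hx.2
      rw [tsub_le_iff_right, ← NNReal.coe_le_coe] at h1
      rw [← NNReal.coe_le_coe] at h2
      push_cast at h1 h2
      rw [Metric.mem_ball, NNReal.dist_eq, abs_lt]
      constructor <;> linarith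
  rw [lintegral_eq_zero_iff (by fun_prop)]
  constructor
  · intro h u hu
    have hopen : {x | 0 < g x} ∈ 𝓝 u := (isOpen_lt continuous_const hg).mem_nhds hu
    obtain ⟨a, b, hau, hub, hn, hsub⟩ := hnhds u _ hopen
    have h0 : hf.stieltjesFunction.measure (Set.Icc a b) = 0 := by
      refine measure_mono_null (fun x hx => ?_) h
      have : 0 < g x := hsub hx
      simpa using this
    rw [hIcc, ENNReal.ofReal_eq_zero] at h0
    filter_upwards [hn] with x hx
    have := hf hx.1
    have := hf hx.2
    have := hf hau
    have := hf hub
    linarith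
  · intro h
    show hf.stieltjesFunction.measure _ = 0
    refine measure_null_of_locally_null _ fun u hu => ?_
    have hu' : 0 < g u := by simpa using hu
    obtain ⟨a, b, hau, hub, hn, hsub⟩ := hnhds u _ (h u hu')
    refine ⟨_, mem_nhdsWithin_of_mem_nhds hn, ?_⟩
    have ha : f a = f u := hsub ⟨le_rfl, hau.trans hub⟩
    have hb : f b = f u := hsub ⟨hau.trans hub, le_rfl⟩
    rw [hIcc, ha, hb]
    simp

/-! ### Allocations with general capacities and their Lipschitz bounds -/

namespace Network

variable {K J : ℕ} (N : Network K J)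

/-- The capacity left over when the allocation `W` is drawn from the cumulative capacities `c`. -/
def residual (c : Fin J → ℝ≥0 → ℝ) (W : ℝ≥0 → Fin K → ℝ) (j : Fin J) (t : ℝ≥0) : ℝ :=
  c j t - (N.C *ᵥ W t) j

/-- The net outflow matrix `(1 - Pᵀ) M`. -/
def G : Matrix (Fin K) (Fin K) ℝ := (1 - N.Pᵀ) * N.M

/-- Levels `E` and allocations `W` of the network with inflow rates `A` and cumulative station
capacities `c`; work conservation says that the residual capacity is locally constant wherever the
station is nonempty. -/
structure IsAllocation (A : Orthant K) (c : Fin J → ℝ≥0 → ℝ) (E : Path K)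
    (W : ℝ≥0 → Fin K → ℝ) : Prop where
  flow : ∀ t k, (E t k : ℝ) = (E 0 k : ℝ) + (A k : ℝ) * (t : ℝ) - (N.G *ᵥ W t) k
  zero : W 0 = 0
  mono : Monotone W
  residual_mono : ∀ j, Monotone (N.residual c W j)
  conserving : ∀ j u, 0 < N.stationLevel E u j →
    ∀ᶠ a in 𝓝 u, N.residual c W j a = N.residual c W j u

variable {N}

theorem C_mulVec (v : Fin K → ℝ) (j : Fin J) :
    (N.C *ᵥ v) j = ∑ k, if N.station k = j then v k else 0 := by
  simp [C, Matrix.mulVec, dotProduct]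

theorem G_mulVec (v : Fin K → ℝ) (k : Fin K) :
    (N.G *ᵥ v) k = N.μ k * v k - ∑ l, N.P l k * (N.μ l * v l) := by
  have h : N.M *ᵥ v = fun l => (N.μ l : ℝ) * v l := by
    ext l; simp [M, Matrix.mulVec_diagonal]
  rw [G, ← Matrix.mulVec_mulVec, h, Matrix.sub_mulVec, Matrix.one_mulVec]
  simp [Matrix.mulVec, dotProduct]

theorem C_mulVec_mono {v w : Fin K → ℝ} (h : v ≤ w) (j : Fin J) :
    (N.C *ᵥ v) j ≤ (N.C *ᵥ w) j := by
  rw [C_mulVec, C_mulVec]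
  refine Finset.sum_le_sum fun k _ => ?_
  split_ifs
  exacts [h k, le_rfl]

theorem stationLevel_pos {Q : Path K} {t : ℝ≥0} {j : Fin J} :
    0 < N.stationLevel Q t j ↔ ∃ k, N.station k = j ∧ 0 < Q t k := by
  have hnn : ∀ k ∈ Finset.univ, 0 ≤ if N.station k = j then (Q t k : ℝ) else 0 := by
    intro k _; split_ifs <;> simp
  rw [stationLevel, C_mulVec, Finset.sum_pos_iff_of_nonneg hnn]
  constructor
  · rintro ⟨k, -, hk⟩
    split_ifs at hk with h
    · exact ⟨k, h, by exact_mod_cast hk⟩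
    · exact absurd hk (lt_irrefl _)
  · rintro ⟨k, h, hk⟩
    exact ⟨k, Finset.mem_univ _, by simpa [h] using hk⟩

/-- One class takes no more than all classes of its station together, and these take no more than
the capacity because the residual is monotone. -/
theorem increment_le {c : Fin J → ℝ≥0 → ℝ} {W : ℝ≥0 → Fin K → ℝ} (hW : Monotone W)
    (hR : ∀ j, Monotone (N.residual c W j)) {a b : ℝ≥0} (hab : a ≤ b) (k : Fin K) :
    W b k - W a k ≤ c (N.station k) b - c (N.station k) a := by
  have h := hR (N.station k) hab
  simp only [residual, C_mulVec] at h
  have h2 : W b k - W a k ≤ ∑ l, ((if N.station l = N.station k then W b l else 0) -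
      if N.station l = N.station k then W a l else 0) := by
    have h3 : ∀ l ∈ Finset.univ, 0 ≤ ((if N.station l = N.station k then W b l else 0) -
      if N.station l = N.station k then W a l else 0) := by
      intro l _
      split_ifs
      · exact sub_nonneg.2 (hW hab l)
      · simp
    have := Finset.single_le_sum h3 (Finset.mem_univ k)
    simpa using this
  rw [Finset.sum_sub_distrib] at h2
  linarith

/-- Capacities whose increments are bounded by the elapsed time. -/
def IsUnitRate (c : Fin J → ℝ≥0 → ℝ) : Prop :=
  ∀ j a b, a ≤ b → 0 ≤ c j b - c j a ∧ c j b - c j a ≤ (b : ℝ) - a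

theorem isUnitRate_time : IsUnitRate (J := J) fun _ t => (t : ℝ) := fun _ a b h =>
  ⟨sub_nonneg.2 (by exact_mod_cast h), le_rfl⟩

/-- What one allocation leaves over can again serve as the capacity of a second one. -/
theorem IsUnitRate.residual {c : Fin J → ℝ≥0 → ℝ} (hc : IsUnitRate c) {W : ℝ≥0 → Fin K → ℝ}
    (hW : Monotone W) (hR : ∀ j, Monotone (N.residual c W j)) : IsUnitRate (N.residual c W) := by
  intro j a b hab
  refine ⟨sub_nonneg.2 (hR j hab), ?_⟩
  have h1 := (hc j a b hab).2
  have h2 := C_mulVec_mono (N := N) (hW hab) j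
  simp only [Network.residual]
  linarith

theorem continuous_of_increments {f : ℝ≥0 → ℝ} {L : ℝ}
    (h : ∀ a b, a ≤ b → |f b - f a| ≤ L * ((b : ℝ) - a)) : Continuous f := by
  have : LipschitzWith L.toNNReal f := by
    refine LipschitzWith.of_dist_le_mul fun x y => ?_
    rw [Real.dist_eq, NNReal.dist_eq]
    have key : ∀ a b : ℝ≥0, a ≤ b → |f b - f a| ≤ L.toNNReal * |(b : ℝ) - a| := by
      intro a b hab
      have hab' : (0 : ℝ) ≤ (b : ℝ) - a := sub_nonneg.2 (by exact_mod_cast hab)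
      rw [abs_of_nonneg hab']
      exact (h a b hab).trans (mul_le_mul_of_nonneg_right (Real.le_coe_toNNReal L) hab')
    rcases le_total x y with hxy | hxy
    · rw [abs_sub_comm, abs_sub_comm (x : ℝ)]; exact key x y hxy
    · exact key y x hxy
  exact this.continuous

theorem IsUnitRate.continuous {c : Fin J → ℝ≥0 → ℝ} (hc : IsUnitRate c) (j : Fin J) :
    Continuous (c j) :=
  continuous_of_increments (L := 1) fun a b hab => by
    rw [abs_of_nonneg (hc j a b hab).1, one_mul]; exact (hc j a b hab).2

/-- A common Lipschitz constant of the levels. -/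
def rate (N : Network K J) (A : Orthant K) : ℝ :=
  ∑ k, ((A k : ℝ) + N.μ k + ∑ l, N.P l k * N.μ l)

theorem rate_term_nonneg (A : Orthant K) (k : Fin K) :
    0 ≤ (A k : ℝ) + N.μ k + ∑ l, N.P l k * N.μ l := by
  have : 0 ≤ ∑ l, N.P l k * N.μ l :=
    Finset.sum_nonneg fun l _ => mul_nonneg (N.P_nonneg l k) (N.μ l).2
  have := (A k).2
  have := (N.μ k).2
  positivity

theorem rate_nonneg (A : Orthant K) : 0 ≤ N.rate A :=
  Finset.sum_nonneg fun k _ => rate_term_nonneg A k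

/-- Stated for bare increments, so that it applies both to genuine solutions and to discrete ones,
where `h` is a difference of grid times. -/
theorem abs_flow_increment_le (A : Orthant K) {w : Fin K → ℝ} {h : ℝ} (hw : ∀ k, 0 ≤ w k)
    (hwh : ∀ k, w k ≤ h) (h0 : 0 ≤ h) (k : Fin K) :
    |(A k : ℝ) * h - (N.G *ᵥ w) k| ≤ ((A k : ℝ) + N.μ k + ∑ l, N.P l k * N.μ l) * h := by
  rw [G_mulVec]
  have h1 : 0 ≤ ∑ l, N.P l k * (N.μ l * w l) :=
    Finset.sum_nonneg fun l _ => mul_nonneg (N.P_nonneg l k) (mul_nonneg (N.μ l).2 (hw l))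
  have h2 : ∑ l, N.P l k * (N.μ l * w l) ≤ (∑ l, N.P l k * N.μ l) * h := by
    rw [Finset.sum_mul]
    refine Finset.sum_le_sum fun l _ => ?_
    rw [← mul_assoc]
    exact mul_le_mul_of_nonneg_left (hwh l) (mul_nonneg (N.P_nonneg l k) (N.μ l).2)
  have h3 : 0 ≤ (N.μ k : ℝ) * w k := mul_nonneg (N.μ k).2 (hw k)
  have h4 : (N.μ k : ℝ) * w k ≤ N.μ k * h := mul_le_mul_of_nonneg_left (hwh k) (N.μ k).2
  have h5 : 0 ≤ (A k : ℝ) * h := mul_nonneg (A k).2 h0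
  rw [abs_le]
  constructor <;> nlinarith

namespace IsAllocation

variable {A : Orthant K} {c : Fin J → ℝ≥0 → ℝ} {E : Path K} {W : ℝ≥0 → Fin K → ℝ}

theorem abs_sub_le (h : N.IsAllocation A c E W) (hc : IsUnitRate c) {a b : ℝ≥0} (hab : a ≤ b)
    (k : Fin K) : |(E b k : ℝ) - E a k| ≤
      ((A k : ℝ) + N.μ k + ∑ l, N.P l k * N.μ l) * ((b : ℝ) - a) := by
  have h1 : (E b k : ℝ) - E a k = A k * ((b : ℝ) - a) - (N.G *ᵥ (W b - W a)) k := by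
    rw [h.flow b, h.flow a, Matrix.mulVec_sub, Pi.sub_apply]; ring
  rw [h1]
  exact abs_flow_increment_le A (fun k => sub_nonneg.2 (h.mono hab k))
    (fun k => (increment_le h.mono h.residual_mono hab k).trans (hc _ _ _ hab).2)
    (sub_nonneg.2 (by exact_mod_cast hab)) k

theorem l1Dist_le (h : N.IsAllocation A c E W) (hc : IsUnitRate c) (a b : ℝ≥0) :
    l1Dist (E a) (E b) ≤ N.rate A * |(a : ℝ) - b| := by
  have key : ∀ a b : ℝ≥0, a ≤ b → l1Dist (E b) (E a) ≤ N.rate A * |(b : ℝ) - a| := by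
    intro a b hab
    rw [abs_of_nonneg (sub_nonneg.2 (by exact_mod_cast hab)), l1Dist, rate, Finset.sum_mul]
    exact Finset.sum_le_sum fun k _ => h.abs_sub_le hc hab k
  rcases le_total a b with hab | hab
  · have := key a b hab
    rw [abs_sub_comm] at this
    refine le_trans (le_of_eq ?_) this
    exact Finset.sum_congr rfl fun k _ => abs_sub_comm _ _
  · exact key b a hab

theorem continuous_level (h : N.IsAllocation A c E W) (hc : IsUnitRate c) (k : Fin K) :
    Continuous fun t => (E t k : ℝ) :=
  continuous_of_increments fun _ _ hab => h.abs_sub_le hc hab k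

theorem continuous_path (h : N.IsAllocation A c E W) (hc : IsUnitRate c) : Continuous E :=
  continuous_pi fun k => continuous_induced_rng.2 (h.continuous_level hc k)

end IsAllocation

theorem continuous_stationLevel {Q : Path K} (h : ∀ k, Continuous fun t => (Q t k : ℝ))
    (j : Fin J) : Continuous fun t => N.stationLevel Q t j := by
  simp only [stationLevel, C_mulVec]
  refine continuous_finsetSum _ fun k _ => ?_
  split_ifs
  exacts [h k, continuous_const]

/-- Fluid solutions in terms of the local form of work conservation. -/
theorem isFluidSolution_iff {Q : Path K} {T : ℝ≥0 → Fin K → ℝ} :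
    N.IsFluidSolution Q T ↔ N.IsAllocation N.α (fun _ t => (t : ℝ)) Q T := by
  have aux : ∀ hT : Monotone T, ∀ hI : ∀ j, Monotone (N.idle T j),
      (∀ k, Continuous fun t => (Q t k : ℝ)) →
      ((∑ j, ∫⁻ t, ENNReal.ofReal (N.stationLevel Q t j) ∂(hI j).stieltjesFunction.measure = 0) ↔
      ∀ j u, 0 < N.stationLevel Q u j → ∀ᶠ a in 𝓝 u, N.idle T j a = N.idle T j u) := by
    intro hT hI hQ
    rw [Finset.sum_eq_zero_iff]
    have hcI : ∀ j, Continuous (N.idle T j) :=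
      ((isUnitRate_time (J := J)).residual (N := N) hT hI).continuous
    constructor
    · intro h j
      exact (lintegral_stieltjes_eq_zero_iff (hI j) (hcI j)
        (continuous_stationLevel hQ j)).1 (h j (Finset.mem_univ j))
    · intro h j _
      exact (lintegral_stieltjes_eq_zero_iff (hI j) (hcI j)
        (continuous_stationLevel hQ j)).2 (h j)
  constructor
  · intro h
    have hQ : ∀ k, Continuous fun t => (Q t k : ℝ) := fun k => by
      refine continuous_of_increments
        (L := (N.α k : ℝ) + N.μ k + ∑ l, N.P l k * N.μ l) fun a b hab => ?_
      have h1 : (Q b k : ℝ) - Q a k = N.α k * ((b : ℝ) - a) - (N.G *ᵥ (T b - T a)) k := by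
        rw [h.flow_balance b, h.flow_balance a, Matrix.mulVec_sub, Pi.sub_apply, G]; ring
      rw [h1]
      exact abs_flow_increment_le _ (fun k => sub_nonneg.2 (h.alloc_mono hab k))
        (increment_le (N := N) (c := fun _ t => (t : ℝ)) h.alloc_mono h.idle_mono hab)
        (sub_nonneg.2 (by exact_mod_cast hab)) k
    exact ⟨h.flow_balance, h.alloc_zero, h.alloc_mono, h.idle_mono,
      (aux h.alloc_mono h.idle_mono hQ).1 h.work_conserving⟩
  · intro h
    exact ⟨h.flow, h.zero, h.mono, h.residual_mono,
      (aux h.mono h.residual_mono (h.continuous_level isUnitRate_time)).2 h.conserving⟩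

theorem mem_fluidLevels {Q : Path K} :
    Q ∈ N.fluidLevels ↔ ∃ T, N.IsAllocation N.α (fun _ t => (t : ℝ)) Q T := by
  simp only [fluidLevels, Set.mem_ofPred_eq, isFluidSolution_iff]


/-! ### Closedness under limits -/

theorem tendsto_mulVec {m n ι : Type*} [Fintype n] {l : Filter ι} (A : Matrix m n ℝ)
    {v : ι → n → ℝ} {w : n → ℝ} (h : Tendsto v l (𝓝 w)) :
    Tendsto (fun i => A *ᵥ v i) l (𝓝 (A *ᵥ w)) :=
  ((Continuous.matrix_mulVec continuous_const continuous_id).tendsto w).comp h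

theorem tendsto_stationLevel {ι : Type*} {l : Filter ι} {Qs : ι → Path K} {Q : Path K} {u : ℝ≥0}
    (h : Tendsto (fun i => Qs i u) l (𝓝 (Q u))) (j : Fin J) :
    Tendsto (fun i => N.stationLevel (Qs i) u j) l (𝓝 (N.stationLevel Q u j)) := by
  have h1 : Tendsto (fun i => fun k => (Qs i u k : ℝ)) l (𝓝 fun k => (Q u k : ℝ)) :=
    tendsto_pi_nhds.2 fun k => NNReal.tendsto_coe.2 (tendsto_pi_nhds.1 h k)
  exact tendsto_pi_nhds.1 (tendsto_mulVec N.C h1) j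

theorem abs_stationLevel_sub_le (Q R : Path K) (a b : ℝ≥0) (j : Fin J) :
    |N.stationLevel Q a j - N.stationLevel R b j| ≤ l1Dist (Q a) (R b) := by
  rw [stationLevel, stationLevel, C_mulVec, C_mulVec, ← Finset.sum_sub_distrib, l1Dist]
  refine (Finset.abs_sum_le_sum_abs _ _).trans (Finset.sum_le_sum fun k _ => ?_)
  split_ifs
  · exact le_rfl
  · simp

theorem IsAllocation.alloc_le {A : Orthant K} {c : Fin J → ℝ≥0 → ℝ} {E : Path K}
    {W : ℝ≥0 → Fin K → ℝ} (h : N.IsAllocation A c E W) (hc : IsUnitRate c) (t : ℝ≥0) (k : Fin K) :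
    0 ≤ W t k ∧ W t k ≤ t := by
  have ht : 0 ≤ t := zero_le
  have h0 : W 0 k = 0 := by rw [h.zero]; rfl
  have h1 : W 0 k ≤ W t k := h.mono ht k
  have h2 := (increment_le h.mono h.residual_mono ht k).trans (hc _ _ _ ht).2
  rw [h0] at h1 h2
  refine ⟨h1, ?_⟩
  simpa using h2

/-- Tychonoff's theorem. With an ultrafilter, convergence holds at all times at once, and no
subsequences are needed. -/
theorem exists_tendsto_pi_of_bounded {ι κ : Type*} (U : Ultrafilter ι) {f : ι → κ → ℝ}
    (lo hi : κ → ℝ) (h : ∀ᶠ i in (U : Filter ι), ∀ x, lo x ≤ f i x ∧ f i x ≤ hi x) :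
    ∃ g : κ → ℝ, Tendsto f U (𝓝 g) := by
  have hK : IsCompact (Set.pi Set.univ fun x => Set.Icc (lo x) (hi x)) :=
    isCompact_univ_pi fun x => isCompact_Icc
  obtain ⟨g, -, hg⟩ := hK.ultrafilter_le_nhds (U.map f) (by
    rw [le_principal_iff]
    show ∀ᶠ i in (U : Filter ι), f i ∈ _
    filter_upwards [h] with i hi x _
    exact hi x)
  exact ⟨g, hg⟩

/-- A locally constant map is continuous into the discrete topology, hence constant on a
preconnected set. -/
theorem eq_of_eventually_eq {X Y : Type*} [TopologicalSpace X] {s : Set X} (hs : IsPreconnected s)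
    {f : X → Y} (hf : ∀ b ∈ s, ∀ᶠ x in 𝓝 b, f x = f b) {x y : X} (hx : x ∈ s) (hy : y ∈ s) :
    f x = f y := by
  let : TopologicalSpace Y := ⊥
  have : DiscreteTopology Y := ⟨rfl⟩
  refine hs.constant (fun b hb => ContinuousAt.continuousWithinAt ?_) hx hy
  rw [ContinuousAt, nhds_discrete Y, tendsto_pure]
  exact hf b hb

/-- The fluid level processes are closed under pointwise limits along ultrafilters. -/
theorem mem_fluidLevels_of_tendsto {ι : Type*} (U : Ultrafilter ι) {Qs : ι → Path K} {Q : Path K}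
    (hQs : ∀ i, Qs i ∈ N.fluidLevels)
    (hQ : ∀ t, Tendsto (fun i => Qs i t) U (𝓝 (Q t))) : Q ∈ N.fluidLevels := by
  choose T hT using fun i => mem_fluidLevels.1 (hQs i)
  have hc := isUnitRate_time (J := J)
  obtain ⟨g, hg⟩ := exists_tendsto_pi_of_bounded U (f := fun i (p : ℝ≥0 × Fin K) => T i p.1 p.2)
    (fun _ => 0) (fun p => (p.1 : ℝ)) (Eventually.of_forall fun i p => (hT i).alloc_le hc p.1 p.2)
  set S : ℝ≥0 → Fin K → ℝ := fun t k => g (t, k)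
  have hS : ∀ t, Tendsto (fun i => T i t) U (𝓝 (S t)) := fun t =>
    tendsto_pi_nhds.2 fun k => tendsto_pi_nhds.1 hg (t, k)
  have hR : ∀ j t, Tendsto (fun i => N.residual (fun _ t => (t : ℝ)) (T i) j t) U
      (𝓝 (N.residual (fun _ t => (t : ℝ)) S j t)) := fun j t =>
    tendsto_const_nhds.sub (tendsto_pi_nhds.1 (tendsto_mulVec N.C (hS t)) j)
  have hQk : ∀ t k, Tendsto (fun i => (Qs i t k : ℝ)) U (𝓝 (Q t k : ℝ)) := fun t k =>
    NNReal.tendsto_coe.2 (tendsto_pi_nhds.1 (hQ t) k)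
  refine mem_fluidLevels.2 ⟨S, ?_, ?_, ?_, ?_, ?_⟩
  · intro t k
    refine tendsto_nhds_unique (hQk t k) ?_
    have := (((hQk 0 k).add_const ((N.α k : ℝ) * t)).sub
      (tendsto_pi_nhds.1 (tendsto_mulVec N.G (hS t)) k))
    exact this.congr fun i => ((hT i).flow t k).symm
  · refine tendsto_nhds_unique (hS 0) ?_
    exact tendsto_const_nhds.congr fun i => (hT i).zero.symm
  · exact fun a b hab => le_of_tendsto_of_tendsto' (hS a) (hS b) fun i => (hT i).mono hab
  · exact fun j a b hab => le_of_tendsto_of_tendsto' (hR j a) (hR j b)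
      fun i => (hT i).residual_mono j hab
  · intro j u hu
    set δ := N.stationLevel Q u j
    set L := N.rate N.α
    have hL : 0 ≤ L := rate_nonneg _
    have hev : ∀ᶠ i in (U : Filter ι), δ / 2 < N.stationLevel (Qs i) u j :=
      (tendsto_stationLevel (hQ u) j).eventually_const_lt (half_lt_self hu)
    -- Radius within which an `L`-Lipschitz level drops by at most `δ / 2`; it does not depend on
    -- `i`, and `L + 1` avoids division by zero.
    have hη : 0 < δ / (2 * (L + 1)) := by positivity
    filter_upwards [Metric.ball_mem_nhds u hη] with a ha
    refine tendsto_nhds_unique_of_eventuallyEq (hR j a) (hR j u) ?_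
    filter_upwards [hev] with i hi
    have hloc : ∀ b ∈ Metric.ball u (δ / (2 * (L + 1))),
        ∀ᶠ x in 𝓝 b, N.residual (fun _ t => (t : ℝ)) (T i) j x =
          N.residual (fun _ t => (t : ℝ)) (T i) j b := by
      intro b hb
      refine (hT i).conserving j b ?_
      rw [Metric.mem_ball, NNReal.dist_eq] at hb
      have h1 := (abs_stationLevel_sub_le (N := N) (Qs i) (Qs i) b u j).trans ((hT i).l1Dist_le hc b u)
      have h2 : L * |(b : ℝ) - u| ≤ (L + 1) * (δ / (2 * (L + 1))) := by gcongr; linarith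
      have h3 : (L + 1) * (δ / (2 * (L + 1))) = δ / 2 := by field_simp
      have := (abs_le.1 h1).1
      linarith
    have hpre : IsPreconnected (Metric.ball u (δ / (2 * (L + 1)))) := by
      have : (Metric.ball u (δ / (2 * (L + 1)))).OrdConnected := by
        constructor
        intro x hx y hy z hz
        rw [Metric.mem_ball, NNReal.dist_eq, abs_lt] at *
        have h1 := NNReal.coe_le_coe.2 hz.1
        have h2 := NNReal.coe_le_coe.2 hz.2
        constructor <;> linarith
      exact this.isPreconnected
    exact eq_of_eventually_eq hpre hloc ha (Metric.mem_ball_self hη)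

/-! ### Scaling, shift and concatenation -/

theorem mem_fluidLevels_scale {Q : Path K} (hQ : Q ∈ N.fluidLevels) {r : ℝ≥0} (hr : 0 < r) :
    (fun t => r⁻¹ • Q (r * t)) ∈ N.fluidLevels := by
  obtain ⟨T, hT⟩ := mem_fluidLevels.1 hQ
  have hr' : (r : ℝ) ≠ 0 := by exact_mod_cast hr.ne'
  have hi : (0 : ℝ) ≤ (r : ℝ)⁻¹ := by positivity
  have hR : ∀ j t, N.residual (fun _ t => (t : ℝ)) (fun t => (r : ℝ)⁻¹ • T (r * t)) j t =
      (r : ℝ)⁻¹ * N.residual (fun _ t => (t : ℝ)) T j (r * t) := by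
    intro j t
    simp only [residual, Matrix.mulVec_smul, Pi.smul_apply, smul_eq_mul]
    push_cast
    field_simp
  refine mem_fluidLevels.2 ⟨fun t => (r : ℝ)⁻¹ • T (r * t), ?_, ?_, ?_, ?_, ?_⟩
  · intro t k
    simp only [Pi.smul_apply, smul_eq_mul, NNReal.coe_mul, NNReal.coe_inv, mul_zero,
      Matrix.mulVec_smul]
    rw [hT.flow]
    push_cast
    field_simp
  · simp [hT.zero]
  · intro a b hab k
    exact mul_le_mul_of_nonneg_left (hT.mono (mul_le_mul_right hab r) k) hi
  · intro j a b hab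
    simp only [hR]
    exact mul_le_mul_of_nonneg_left (hT.residual_mono j (mul_le_mul_right hab r)) hi
  · intro j u hu
    simp only [hR]
    have hu' : 0 < N.stationLevel Q (r * u) j := by
      obtain ⟨k, hk, h⟩ := stationLevel_pos.1 hu
      exact stationLevel_pos.2 ⟨k, hk, pos_of_mul_pos_right h (zero_le)⟩
    have hcont : Tendsto (fun t : ℝ≥0 => r * t) (𝓝 u) (𝓝 (r * u)) :=
      (continuous_const.mul continuous_id).tendsto u
    filter_upwards [hcont.eventually (hT.conserving j _ hu')] with a ha
    rw [ha]

theorem mem_fluidLevels_shift {Q : Path K} (hQ : Q ∈ N.fluidLevels) (s : ℝ≥0) :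
    (fun t => Q (s + t)) ∈ N.fluidLevels := by
  obtain ⟨T, hT⟩ := mem_fluidLevels.1 hQ
  have hR : ∀ j t, N.residual (fun _ t => (t : ℝ)) (fun t => T (s + t) - T s) j t =
      N.residual (fun _ t => (t : ℝ)) T j (s + t) - N.residual (fun _ t => (t : ℝ)) T j s := by
    intro j t
    simp only [residual, Matrix.mulVec_sub, Pi.sub_apply]
    push_cast
    ring
  refine mem_fluidLevels.2 ⟨fun t => T (s + t) - T s, ?_, ?_, ?_, ?_, ?_⟩
  · intro t k
    simp only [Matrix.mulVec_sub, Pi.sub_apply, add_zero]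
    rw [hT.flow (s + t), hT.flow s]
    push_cast
    ring
  · simp
  · intro a b hab k
    exact sub_le_sub_right (hT.mono (add_le_add_right hab s) k) _
  · intro j a b hab
    simp only [hR]
    exact sub_le_sub_right (hT.residual_mono j (add_le_add_right hab s)) _
  · intro j u hu
    simp only [hR]
    have hcont : Tendsto (fun t : ℝ≥0 => s + t) (𝓝 u) (𝓝 (s + u)) :=
      (continuous_const.add continuous_id).tendsto u
    filter_upwards [hcont.eventually (hT.conserving j _ hu)] with a ha
    rw [ha]

theorem mem_fluidLevels_concat {Q₁ Q₂ : Path K} (h₁ : Q₁ ∈ N.fluidLevels)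
    (h₂ : Q₂ ∈ N.fluidLevels) (τ : ℝ≥0) (h : Q₁ τ = Q₂ 0) :
    concat Q₁ τ Q₂ ∈ N.fluidLevels := by
  obtain ⟨T₁, hT₁⟩ := mem_fluidLevels.1 h₁
  obtain ⟨T₂, hT₂⟩ := mem_fluidLevels.1 h₂
  -- Splitting the clock into the time spent on each path makes flow balance and residuals additive,
  -- without a case distinction at `τ`.
  have hsplit : ∀ t : ℝ≥0, (t : ℝ) = ((min t τ : ℝ≥0) : ℝ) + ((t - τ : ℝ≥0) : ℝ) := by
    intro t
    rw [← NNReal.coe_add, min_comm]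
    congr 1
    rcases le_total t τ with ht | ht
    · rw [min_eq_right ht, tsub_eq_zero_of_le ht, add_zero]
    · rw [min_eq_left ht, add_tsub_cancel_of_le ht]
  have hR : ∀ j t, N.residual (fun _ t => (t : ℝ)) (fun t => T₁ (min t τ) + T₂ (t - τ)) j t =
      N.residual (fun _ t => (t : ℝ)) T₁ j (min t τ) +
        N.residual (fun _ t => (t : ℝ)) T₂ j (t - τ) := by
    intro j t
    simp only [residual, Matrix.mulVec_add, Pi.add_apply]
    have := hsplit t
    linarith
  have hQ : ∀ t k, (concat Q₁ τ Q₂ t k : ℝ) =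
      (Q₁ (min t τ) k : ℝ) + ((Q₂ (t - τ) k : ℝ) - Q₂ 0 k) := by
    intro t k
    rw [concat]
    split_ifs with ht
    · rw [min_eq_left ht, tsub_eq_zero_of_le ht]; ring
    · rw [min_eq_right (not_le.1 ht).le, h]; ring
  refine mem_fluidLevels.2 ⟨fun t => T₁ (min t τ) + T₂ (t - τ), ?_, ?_, ?_, ?_, ?_⟩
  · intro t k
    rw [hQ t, hQ 0, hT₁.flow (min t τ), hT₂.flow (t - τ)]
    have h0 : min (0 : ℝ≥0) τ = 0 := min_eq_left zero_le
    simp only [h0, zero_tsub, sub_self, add_zero, Matrix.mulVec_add, Pi.add_apply]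
    rw [hsplit t]
    ring
  · simp [hT₁.zero, hT₂.zero]
  · intro a b hab
    exact add_le_add (hT₁.mono (min_le_min_right τ hab)) (hT₂.mono (tsub_le_tsub_right hab τ))
  · intro j a b hab
    simp only [hR]
    exact add_le_add (hT₁.residual_mono j (min_le_min_right τ hab))
      (hT₂.residual_mono j (tsub_le_tsub_right hab τ))
  · intro j u hu
    simp only [hR]
    have hmin : Tendsto (fun t : ℝ≥0 => min t τ) (𝓝 u) (𝓝 (min u τ)) :=
      (continuous_id.min continuous_const).tendsto u
    have hsub : Tendsto (fun t : ℝ≥0 => t - τ) (𝓝 u) (𝓝 (u - τ)) :=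
      (continuous_id.sub continuous_const).tendsto u
    -- Each summand is either frozen near `u` or governed by its own work conservation. At `u = τ`
    -- both are active, and the matching levels `Q₁ τ = Q₂ 0` make both stations nonempty.
    have e₁ : ∀ᶠ a in 𝓝 u, N.residual (fun _ t => (t : ℝ)) T₁ j (min a τ) =
        N.residual (fun _ t => (t : ℝ)) T₁ j (min u τ) := by
      rcases le_or_gt u τ with hle | hlt
      · refine hmin.eventually (hT₁.conserving j _ ?_)
        rw [min_eq_left hle]
        simpa [stationLevel, concat, hle] using hu
      · filter_upwards [lt_mem_nhds hlt] with a ha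
        rw [min_eq_right ha.le, min_eq_right hlt.le]
    have e₂ : ∀ᶠ a in 𝓝 u, N.residual (fun _ t => (t : ℝ)) T₂ j (a - τ) =
        N.residual (fun _ t => (t : ℝ)) T₂ j (u - τ) := by
      rcases lt_or_ge u τ with hlt | hge
      · filter_upwards [gt_mem_nhds hlt] with a ha
        rw [tsub_eq_zero_of_le ha.le, tsub_eq_zero_of_le hlt.le]
      · refine hsub.eventually (hT₂.conserving j _ ?_)
        rcases hge.eq_or_lt with rfl | hlt
        · simpa [stationLevel, concat, h] using hu
        · simpa [stationLevel, concat, not_le.2 hlt] using hu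
    filter_upwards [e₁, e₂] with a h₁ h₂
    rw [h₁, h₂]


/-! ### Existence of work-conserving allocations by discretization -/

/-- One step of a work-conserving allocation of the capacities `c` to the levels `e`. -/
theorem exists_step (N : Network K J) (e : Orthant K) {c : Fin J → ℝ} (hc : ∀ j, 0 ≤ c j) :
    ∃ w : Fin K → ℝ, (∀ k, 0 ≤ w k) ∧ (∀ k, N.μ k * w k ≤ e k) ∧
      ∀ j, (N.C *ᵥ w) j ≤ c j ∧
        ((N.C *ᵥ w) j = c j ∨ ∀ k, N.station k = j → N.μ k * w k = e k) := by
  -- The time needed to empty class `k`. A class with zero outflow rate cannot be drained, so it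
  -- asks for the whole capacity of its station.
  set d : Fin K → ℝ := fun k => if N.μ k = 0 then c (N.station k) else e k / N.μ k
  have hd : ∀ k, 0 ≤ d k := by
    intro k
    simp only [d]
    split_ifs
    · exact hc _
    · positivity
  have hde : ∀ k, N.μ k * d k ≤ e k := by
    intro k
    simp only [d]
    split_ifs with h
    · simp [h]
    · have : (N.μ k : ℝ) ≠ 0 := by exact_mod_cast h
      rw [mul_div_cancel₀ _ this]
  set S : Fin J → ℝ := fun j => (N.C *ᵥ d) j
  have hS : ∀ j, S j = ∑ k, if N.station k = j then d k else 0 := fun j => C_mulVec d j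
  have hdS : ∀ k, d k ≤ S (N.station k) := by
    intro k
    have h0 : ∀ l ∈ Finset.univ, 0 ≤ if N.station l = N.station k then d l else 0 := by
      intro l _; split_ifs <;> simp [hd]
    have := Finset.single_le_sum h0 (Finset.mem_univ k)
    rw [hS]
    simpa using this
  have hS0 : ∀ j, 0 ≤ S j := by
    intro j
    rw [hS]
    exact Finset.sum_nonneg fun k _ => by split_ifs <;> simp [hd]
  -- An overloaded station cuts all demands by the same factor, which uses up its capacity exactly.
  set θ : Fin J → ℝ := fun j => if S j ≤ c j then 1 else c j / S j
  have hθ : ∀ j, 0 ≤ θ j ∧ θ j ≤ 1 := by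
    intro j
    simp only [θ]
    split_ifs with h
    · simp
    · have hpos : 0 < S j := (hc j).trans_lt (not_le.1 h)
      exact ⟨div_nonneg (hc j) hpos.le, (div_le_one hpos).2 (not_le.1 h).le⟩
  have hsum : ∀ j, (N.C *ᵥ fun k => θ (N.station k) * d k) j = θ j * S j := by
    intro j
    rw [C_mulVec, hS, Finset.mul_sum]
    refine Finset.sum_congr rfl fun k _ => ?_
    split_ifs with h
    · rw [h]
    · simp
  refine ⟨fun k => θ (N.station k) * d k, fun k => mul_nonneg (hθ _).1 (hd k), fun k => ?_,
    fun j => ?_⟩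
  · refine le_trans ?_ (hde k)
    exact mul_le_mul_of_nonneg_left (mul_le_of_le_one_left (hd k) (hθ _).2) (N.μ k).2
  · rw [hsum]
    by_cases h : S j ≤ c j
    · have h1 : θ j = 1 := if_pos h
      rw [h1, one_mul]
      refine ⟨h, ?_⟩
      by_cases hμ : ∃ k, N.station k = j ∧ N.μ k = 0
      · left
        obtain ⟨k, rfl, hk⟩ := hμ
        refine le_antisymm h ?_
        have := hdS k
        simpa [d, hk] using this
      · right
        intro k hk
        have hk0 : N.μ k ≠ 0 := fun h0 => hμ ⟨k, hk, h0⟩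
        have hk0' : (N.μ k : ℝ) ≠ 0 := by exact_mod_cast hk0
        simp only [d, hk, h1, one_mul, if_neg hk0]
        rw [mul_div_cancel₀ _ hk0']
    · have h1 : θ j = c j / S j := if_neg h
      have hpos : S j ≠ 0 := ((hc j).trans_lt (not_le.1 h)).ne'
      rw [h1, div_mul_cancel₀ _ hpos]
      exact ⟨le_rfl, Or.inl rfl⟩

/-- The discrete-time work-conserving allocation with step `h`. -/
theorem exists_discrete_allocation (N : Network K J) (A : Orthant K) {c : Fin J → ℝ≥0 → ℝ}
    (hc : IsUnitRate c) (x : Orthant K) (h : ℝ≥0) :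
    ∃ (e : ℕ → Orthant K) (w : ℕ → Fin K → ℝ), w 0 = 0 ∧ Monotone w ∧
      (∀ m k, (e m k : ℝ) = (x k : ℝ) + A k * ((m * h : ℝ≥0) : ℝ) - (N.G *ᵥ w m) k) ∧
      (∀ j, Monotone fun m : ℕ => c j (m * h) - (N.C *ᵥ w m) j) ∧
      ∀ j m, c j ((m + 1 : ℕ) * h) - (N.C *ᵥ w (m + 1)) j = c j (m * h) - (N.C *ᵥ w m) j ∨
        (N.C *ᵥ fun k => (e (m + 1) k : ℝ)) j ≤ N.rate A * h := by
  have hle : ∀ m : ℕ, (m * h : ℝ≥0) ≤ (m + 1 : ℕ) * h := fun m => by gcongr; simp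
  choose v hv0 hve hvc using fun (m : ℕ) (e : Orthant K) =>
    exists_step N e (c := fun j => c j ((m + 1 : ℕ) * h) - c j (m * h)) fun j => (hc j _ _ (hle m)).1
  obtain ⟨e, he0, hes⟩ : ∃ e : ℕ → Orthant K, e 0 = x ∧ ∀ m, e (m + 1) =
      fun k => ((e m k : ℝ) + A k * h - (N.G *ᵥ v m (e m)) k).toNNReal :=
    ⟨fun m => Nat.rec x (fun m y k => ((y k : ℝ) + A k * h - (N.G *ᵥ v m y) k).toNNReal) m,
      rfl, fun _ => rfl⟩
  let w : ℕ → Fin K → ℝ := fun m => ∑ i ∈ Finset.range m, v i (e i)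
  have hw : ∀ m, w (m + 1) = w m + v m (e m) := fun m => Finset.sum_range_succ _ _
  have hvh : ∀ m k, v m (e m) k ≤ h := by
    intro m k
    have h1 := (hvc m (e m) (N.station k)).1
    have h2 := (hc (N.station k) _ _ (hle m)).2
    have h3 : v m (e m) k ≤ (N.C *ᵥ v m (e m)) (N.station k) := by
      rw [C_mulVec]
      have h0 : ∀ l ∈ Finset.univ, 0 ≤ if N.station l = N.station k then v m (e m) l else 0 := by
        intro l _; split_ifs <;> simp [hv0]
      have := Finset.single_le_sum h0 (Finset.mem_univ k)
      simpa using this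
    have h4 : (((m + 1 : ℕ) * h : ℝ≥0) : ℝ) - ((m * h : ℝ≥0) : ℝ) = h := by push_cast; ring
    linarith
  have hin : ∀ m k, 0 ≤ ∑ l, N.P l k * (N.μ l * v m (e m) l) := fun m k =>
    Finset.sum_nonneg fun l _ =>
      mul_nonneg (N.P_nonneg l k) (mul_nonneg (N.μ l).2 (hv0 m (e m) l))
  -- The truncation in the recursion is never active: a step removes at most the fluid present.
  have he : ∀ (m : ℕ) (k : Fin K), (e (m + 1) k : ℝ) = (e m k : ℝ) + A k * h - (N.G *ᵥ v m (e m)) k := by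
    intro m k
    rw [hes]
    refine Real.coe_toNNReal _ ?_
    rw [G_mulVec]
    have := hve m (e m) k
    have := hin m k
    have : 0 ≤ (A k : ℝ) * h := mul_nonneg (A k).2 h.2
    linarith
  refine ⟨e, w, by simp [w], ?_, ?_, ?_, ?_⟩
  · exact monotone_nat_of_le_succ fun m => by
      rw [hw]; exact le_add_of_nonneg_right (hv0 m (e m))
  · intro m k
    induction m with
    | zero => simp [w, he0]
    | succ m ih =>
      rw [he, ih, hw, Matrix.mulVec_add, Pi.add_apply]
      push_cast
      ring
  · intro j
    refine monotone_nat_of_le_succ fun m => ?_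
    rw [hw, Matrix.mulVec_add, Pi.add_apply]
    have := (hvc m (e m) j).1
    linarith
  · intro j m
    rcases (hvc m (e m) j).2 with h1 | h1
    · left
      rw [hw, Matrix.mulVec_add, Pi.add_apply]
      linarith
    -- The step empties what the station held at its start, so only the fluid that entered during
    -- the step remains, which is of order `h`.
    · right
      rw [C_mulVec, rate, Finset.sum_mul]
      refine Finset.sum_le_sum fun k _ => ?_
      split_ifs with hk
      · rw [he, G_mulVec, h1 k hk]
        have h2 : ∑ l, N.P l k * (N.μ l * v m (e m) l) ≤ (∑ l, N.P l k * N.μ l) * h := by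
          rw [Finset.sum_mul]
          refine Finset.sum_le_sum fun l _ => ?_
          rw [← mul_assoc]
          exact mul_le_mul_of_nonneg_left (hvh m l) (mul_nonneg (N.P_nonneg l k) (N.μ l).2)
        have h3 : 0 ≤ (N.μ k : ℝ) * h := mul_nonneg (N.μ k).2 h.2
        nlinarith
      · exact mul_nonneg (rate_term_nonneg A k) h.2

/-- The last grid time of step `h` before `t`. -/
noncomputable def gridTime (h t : ℝ≥0) : ℝ≥0 := ⌊t / h⌋₊ * h

theorem gridTime_mono (h : ℝ≥0) : Monotone (gridTime h) := fun a b hab => by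
  unfold gridTime; gcongr

theorem gridTime_le {h : ℝ≥0} (hh : 0 < h) (t : ℝ≥0) : gridTime h t ≤ t := by
  have := Nat.floor_le (zero_le : 0 ≤ t / h)
  calc gridTime h t ≤ t / h * h := by unfold gridTime; gcongr
    _ = t := div_mul_cancel₀ _ hh.ne'

theorem lt_gridTime_add {h : ℝ≥0} (hh : 0 < h) (t : ℝ≥0) : t < gridTime h t + h := by
  have := Nat.lt_floor_add_one (t / h)
  calc t = t / h * h := (div_mul_cancel₀ _ hh.ne').symm
    _ < (⌊t / h⌋₊ + 1) * h := by gcongr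
    _ = gridTime h t + h := by unfold gridTime; ring

theorem abs_gridTime_sub_le {h : ℝ≥0} (hh : 0 < h) (a b : ℝ≥0) :
    |(gridTime h a : ℝ) - gridTime h b| ≤ |(a : ℝ) - b| + h := by
  have h1 := NNReal.coe_le_coe.2 (gridTime_le hh a)
  have h2 := NNReal.coe_le_coe.2 (gridTime_le hh b)
  have h3 := NNReal.coe_lt_coe.2 (lt_gridTime_add hh a)
  have h4 := NNReal.coe_lt_coe.2 (lt_gridTime_add hh b)
  push_cast at h3 h4
  have h5 := neg_abs_le ((a : ℝ) - b)
  have h6 := le_abs_self ((a : ℝ) - b)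
  rw [abs_le]
  constructor <;> linarith

/-- Piecewise constant interpolation of the discrete scheme. Work conservation holds only above the
threshold `N.rate A * h`, which vanishes with the step. -/
theorem exists_step_allocation (N : Network K J) (A : Orthant K) {c : Fin J → ℝ≥0 → ℝ}
    (hc : IsUnitRate c) (x : Orthant K) {h : ℝ≥0} (hh : 0 < h) :
    ∃ (E : Path K) (W : ℝ≥0 → Fin K → ℝ), W 0 = 0 ∧ Monotone W ∧
      (∀ t k, (E t k : ℝ) = (x k : ℝ) + A k * (gridTime h t : ℝ) - (N.G *ᵥ W t) k) ∧
      (∀ j, Monotone (N.residual (fun j t => c j (gridTime h t)) W j)) ∧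
      ∀ j a b, a ≤ b → (∀ t ∈ Set.Icc a b, N.rate A * h < N.stationLevel E t j) →
        N.residual (fun j t => c j (gridTime h t)) W j a =
          N.residual (fun j t => c j (gridTime h t)) W j b := by
  obtain ⟨e, w, hw0, hw, he, hr, hcons⟩ := exists_discrete_allocation N A hc x h
  have hfl : Monotone fun t : ℝ≥0 => ⌊t / h⌋₊ := fun a b hab => Nat.floor_le_floor (by gcongr)
  refine ⟨fun t => e ⌊t / h⌋₊, fun t => w ⌊t / h⌋₊, by simpa using hw0, hw.comp hfl,
    fun t k => he _ k, fun j => (hr j).comp hfl, ?_⟩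
  intro j a b hab hpos
  have key : ∀ m, ⌊a / h⌋₊ ≤ m → m ≤ ⌊b / h⌋₊ →
      c j (⌊a / h⌋₊ * h) - (N.C *ᵥ w ⌊a / h⌋₊) j = c j (m * h) - (N.C *ᵥ w m) j := by
    intro m ham
    induction m, ham using Nat.le_induction with
    | base => intro _; rfl
    | succ m ham ih =>
      intro hmb
      rw [ih (by omega)]
      rcases hcons j m with h1 | h1
      · exact h1.symm
      · exfalso
        -- At the grid time itself the level is `e (m + 1)`, which contradicts the small bound on
        -- it.
        have h2 := hpos ((m + 1 : ℕ) * h) ⟨?_, ?_⟩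
        · simp only [stationLevel, mul_div_cancel_right₀ _ hh.ne', Nat.floor_natCast] at h2
          linarith
        · have h3 : a / h < (⌊a / h⌋₊ + 1 : ℕ) := by exact_mod_cast Nat.lt_floor_add_one (a / h)
          have h4 : ((⌊a / h⌋₊ + 1 : ℕ) : ℝ≥0) ≤ (m + 1 : ℕ) := by exact_mod_cast Nat.succ_le_succ ham
          exact ((div_lt_iff₀ hh).1 (h3.trans_le h4)).le
        · have h3 : ((m + 1 : ℕ) : ℝ≥0) ≤ b / h :=
            (Nat.cast_le.2 hmb).trans (Nat.floor_le zero_le)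
          exact (le_div_iff₀ hh).1 h3
  exact key _ (hfl hab) le_rfl

/-- Work-conserving allocations exist for all inflow rates, capacities and initial levels. -/
theorem exists_allocation (N : Network K J) (A : Orthant K) {c : Fin J → ℝ≥0 → ℝ}
    (hc : IsUnitRate c) (x : Orthant K) : ∃ E W, E 0 = x ∧ N.IsAllocation A c E W := by
  let h : ℕ → ℝ≥0 := fun n => 1 / ((n : ℝ≥0) + 1)
  have hh : ∀ n, 0 < h n := fun n => by positivity
  have hlim : Tendsto (fun n => (h n : ℝ)) atTop (𝓝 0) := by
    simpa [h] using tendsto_one_div_add_atTop_nhds_zero_nat (𝕜 := ℝ)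
  choose E W hW0 hW hflow hres hcons using fun n => exists_step_allocation N A hc x (hh n)
  obtain ⟨U, hU⟩ : ∃ U : Ultrafilter ℕ, (U : Filter ℕ) ≤ atTop :=
    ⟨Ultrafilter.of atTop, Ultrafilter.of_le atTop⟩
  have hgrid : ∀ t, Tendsto (fun n => gridTime (h n) t) U (𝓝 t) := by
    intro t
    rw [← NNReal.tendsto_coe]
    refine tendsto_of_tendsto_of_tendsto_of_le_of_le (g := fun n => (t : ℝ) - h n)
      (h := fun _ => (t : ℝ)) ?_ tendsto_const_nhds ?_ ?_
    · simpa using (hlim.mono_left hU).const_sub (t : ℝ)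
    · intro n
      have := NNReal.coe_lt_coe.2 (lt_gridTime_add (hh n) t)
      push_cast at this
      show (t : ℝ) - h n ≤ gridTime (h n) t
      linarith
    · exact fun n => NNReal.coe_le_coe.2 (gridTime_le (hh n) t)
  have hinc : ∀ n k a b, a ≤ b → W n b k - W n a k ≤
      (gridTime (h n) b : ℝ) - gridTime (h n) a := fun n k a b hab =>
    (increment_le (hW n) (hres n) hab k).trans (hc _ _ _ (gridTime_mono _ hab)).2
  obtain ⟨g, hg⟩ := exists_tendsto_pi_of_bounded U (f := fun n (p : ℝ≥0 × Fin K) => W n p.1 p.2)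
    (fun _ => 0) (fun p => (p.1 : ℝ)) (Eventually.of_forall fun n p => by
      have hp : (0 : ℝ≥0) ≤ p.1 := zero_le
      have h0 : W n 0 p.2 = 0 := by rw [hW0]; rfl
      have h1 : W n 0 p.2 ≤ W n p.1 p.2 := hW n hp p.2
      have h2 := hinc n p.2 _ _ hp
      have h3 := NNReal.coe_le_coe.2 (gridTime_le (hh n) p.1)
      have h4 := (gridTime (h n) 0).2
      rw [h0] at h1 h2
      exact ⟨h1, by linarith⟩)
  set V : ℝ≥0 → Fin K → ℝ := fun t k => g (t, k)
  have hV : ∀ t, Tendsto (fun n => W n t) U (𝓝 (V t)) := fun t =>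
    tendsto_pi_nhds.2 fun k => tendsto_pi_nhds.1 hg (t, k)
  have hV0 : V 0 = 0 := tendsto_nhds_unique (hV 0) (tendsto_const_nhds.congr fun n => (hW0 n).symm)
  have hR : ∀ j t, Tendsto (fun n => N.residual (fun j t => c j (gridTime (h n) t)) (W n) j t) U
      (𝓝 (N.residual c V j t)) := fun j t =>
    (((hc.continuous j).tendsto t).comp (hgrid t)).sub
      (tendsto_pi_nhds.1 (tendsto_mulVec N.C (hV t)) j)
  let F : Path K := fun t k => ((x k : ℝ) + A k * (t : ℝ) - (N.G *ᵥ V t) k).toNNReal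
  have hEk : ∀ t k, Tendsto (fun n => (E n t k : ℝ)) U
      (𝓝 ((x k : ℝ) + A k * (t : ℝ) - (N.G *ᵥ V t) k)) := fun t k =>
    (((((NNReal.tendsto_coe.2 (hgrid t)).const_mul (A k : ℝ)).const_add (x k : ℝ))).sub
      (tendsto_pi_nhds.1 (tendsto_mulVec N.G (hV t)) k)).congr fun n => (hflow n t k).symm
  have hF : ∀ t k, (F t k : ℝ) = (x k : ℝ) + A k * (t : ℝ) - (N.G *ᵥ V t) k := fun t k =>
    Real.coe_toNNReal _ (ge_of_tendsto' (hEk t k) fun n => (E n t k).2)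
  have hE : ∀ t, Tendsto (fun n => E n t) U (𝓝 (F t)) := fun t =>
    tendsto_pi_nhds.2 fun k => NNReal.tendsto_coe.1 (by rw [hF]; exact hEk t k)
  have hF0 : F 0 = x := by
    ext k
    rw [hF, hV0]
    simp
  -- The paths jump, so they are Lipschitz only up to an error of one step.
  have hdist : ∀ n a b, l1Dist (E n a) (E n b) ≤ N.rate A * (|(a : ℝ) - b| + h n) := by
    have key : ∀ n a b, a ≤ b → l1Dist (E n b) (E n a) ≤
        N.rate A * |(gridTime (h n) b : ℝ) - gridTime (h n) a| := by
      intro n a b hab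
      have h0 : (0 : ℝ) ≤ (gridTime (h n) b : ℝ) - gridTime (h n) a :=
        sub_nonneg.2 (NNReal.coe_le_coe.2 (gridTime_mono _ hab))
      rw [abs_of_nonneg h0, l1Dist, rate, Finset.sum_mul]
      refine Finset.sum_le_sum fun k _ => ?_
      have h1 : (E n b k : ℝ) - E n a k = A k * ((gridTime (h n) b : ℝ) - gridTime (h n) a) -
          (N.G *ᵥ (W n b - W n a)) k := by
        rw [hflow n b, hflow n a, Matrix.mulVec_sub, Pi.sub_apply]; ring
      rw [h1]
      exact abs_flow_increment_le A (fun k => sub_nonneg.2 (hW n hab k))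
        (fun k => hinc n k a b hab) h0 k
    intro n a b
    refine le_trans ?_ (mul_le_mul_of_nonneg_left (abs_gridTime_sub_le (hh n) a b)
      (rate_nonneg A))
    rcases le_total a b with hab | hab
    · have := key n a b hab
      rw [abs_sub_comm] at this
      exact le_trans (le_of_eq (Finset.sum_congr rfl fun k _ => abs_sub_comm _ _)) this
    · exact key n b a hab
  refine ⟨F, V, hF0, ?_, hV0, ?_, ?_, ?_⟩
  · intro t k
    rw [hF0, hF]
  · exact fun a b hab => le_of_tendsto_of_tendsto' (hV a) (hV b) fun n => hW n hab
  · exact fun j a b hab => le_of_tendsto_of_tendsto' (hR j a) (hR j b) fun n => hres n j hab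
  · intro j u hu
    set δ := N.stationLevel F u j
    set L := N.rate A
    have hL : 0 ≤ L := rate_nonneg _
    have hev : ∀ᶠ n in (U : Filter ℕ), δ / 2 < N.stationLevel (E n) u j :=
      (tendsto_stationLevel (hE u) j).eventually_const_lt (half_lt_self hu)
    -- Near `u` the approximate level is then at least `δ / 2 - δ / 4`, above the threshold `L * h n
    -- ≤ δ / 8`.
    have hη : 0 < δ / (8 * (L + 1)) := by positivity
    have hsmall : ∀ᶠ n in (U : Filter ℕ), (h n : ℝ) < δ / (8 * (L + 1)) :=
      (hlim.mono_left hU).eventually_lt_const hη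
    filter_upwards [Metric.ball_mem_nhds u hη] with a ha
    rw [Metric.mem_ball, NNReal.dist_eq] at ha
    refine tendsto_nhds_unique_of_eventuallyEq (hR j a) (hR j u) ?_
    filter_upwards [hev, hsmall] with n hn hn'
    have hloc : ∀ b : ℝ≥0, |(b : ℝ) - u| ≤ |(a : ℝ) - u| → L * h n < N.stationLevel (E n) b j := by
      intro b hb
      have h1 := (abs_stationLevel_sub_le (N := N) (E n) (E n) b u j).trans (hdist n b u)
      have h2 : L * (|(b : ℝ) - u| + h n) ≤
          (L + 1) * (δ / (8 * (L + 1)) + δ / (8 * (L + 1))) := by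
        gcongr <;> linarith
      have h3 : (L + 1) * (δ / (8 * (L + 1)) + δ / (8 * (L + 1))) = δ / 4 := by field_simp; ring
      have h4 : L * h n ≤ (L + 1) * (δ / (8 * (L + 1))) := by gcongr; linarith
      have h5 : (L + 1) * (δ / (8 * (L + 1))) = δ / 8 := by field_simp
      have := (abs_le.1 h1).1
      linarith
    rcases le_total a u with hau | hau
    · refine hcons n j a u hau fun t ht => hloc t ?_
      have h1 := NNReal.coe_le_coe.2 ht.1
      have h2 := NNReal.coe_le_coe.2 ht.2
      rw [abs_of_nonpos (by linarith), abs_of_nonpos (by linarith)]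
      linarith
    · refine (hcons n j u a hau fun t ht => hloc t ?_).symm
      have h1 := NNReal.coe_le_coe.2 ht.1
      have h2 := NNReal.coe_le_coe.2 ht.2
      rw [abs_of_nonneg (by linarith), abs_of_nonneg (by linarith)]
      linarith

end Network
end FluidNet

/-! ### The norm, domination and lower semicontinuity -/

namespace FluidNet

theorem dist_le_l1Dist {K : ℕ} (x y : Orthant K) : dist x y ≤ l1Dist x y := by
  have h0 : ∀ k ∈ Finset.univ, 0 ≤ |(x k : ℝ) - y k| := fun k _ => abs_nonneg _
  rw [l1Dist, dist_pi_le_iff (Finset.sum_nonneg h0)]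
  intro k
  rw [NNReal.dist_eq]
  exact Finset.single_le_sum h0 (Finset.mem_univ k)

theorem coe_l1 {K : ℕ} (x : Orthant K) : (l1 x : ℝ) = ∑ k, (x k : ℝ) := by
  simp [l1]

theorem continuous_l1 {K : ℕ} : Continuous (l1 : Orthant K → ℝ≥0) :=
  continuous_finsetSum _ fun k _ => continuous_apply k

theorem l1_smul {K : ℕ} (r : ℝ≥0) (x : Orthant K) : l1 (r • x) = r * l1 x := by
  simp [l1, Finset.mul_sum]

theorem l1_mono {K : ℕ} {x y : Orthant K} (h : x ≤ y) : l1 x ≤ l1 y :=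
  Finset.sum_le_sum fun k _ => h k

theorem abs_l1_sub_le {K : ℕ} (x y : Orthant K) : |(l1 x : ℝ) - l1 y| ≤ l1Dist x y := by
  rw [coe_l1, coe_l1, ← Finset.sum_sub_distrib]
  exact Finset.abs_sum_le_sum_abs _ _

theorem eq_zero_of_l1 {K : ℕ} {x : Orthant K} (h : l1 x = 0) : x = 0 := by
  ext k
  simpa using congrArg NNReal.toReal ((Finset.sum_eq_zero_iff.1 h) k (Finset.mem_univ k))

theorem continuous_l1Dist {K : ℕ} : Continuous fun p : Orthant K × Orthant K => l1Dist p.1 p.2 := by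
  unfold l1Dist
  fun_prop

theorem l1Dist_self {K : ℕ} (x : Orthant K) : l1Dist x x = 0 := by simp [l1Dist]

theorem l1Dist_triangle {K : ℕ} (x y z : Orthant K) : l1Dist x z ≤ l1Dist x y + l1Dist y z := by
  rw [l1Dist, l1Dist, l1Dist, ← Finset.sum_add_distrib]
  exact Finset.sum_le_sum fun k _ => abs_sub_le _ _ _

theorem l1Dist_smul_left {K : ℕ} (r : ℝ≥0) (x : Orthant K) :
    l1Dist (r • x) x = |(r : ℝ) - 1| * l1 x := by
  rw [coe_l1, Finset.mul_sum]
  refine Finset.sum_congr rfl fun k _ => ?_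
  have h : ((r • x) k : ℝ) - x k = ((r : ℝ) - 1) * x k := by
    simp only [Pi.smul_apply, smul_eq_mul, NNReal.coe_mul]; ring
  rw [h, abs_mul, abs_of_nonneg (NNReal.coe_nonneg (x k))]

namespace Network

variable {K J : ℕ} {N : Network K J}

theorem exists_mem_fluidLevels (N : Network K J) (x : Orthant K) :
    ∃ Q ∈ N.fluidLevels, Q 0 = x := by
  obtain ⟨Q, T, h0, hT⟩ := exists_allocation N N.α isUnitRate_time x
  exact ⟨Q, mem_fluidLevels.2 ⟨T, hT⟩, h0⟩

/-- Row sums of `P` are at most one, so service cannot increase the total amount of fluid. -/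
theorem sum_G_mulVec_nonneg {w : Fin K → ℝ} (hw : ∀ k, 0 ≤ w k) : 0 ≤ ∑ k, (N.G *ᵥ w) k := by
  simp only [G_mulVec]
  rw [Finset.sum_sub_distrib, Finset.sum_comm, sub_nonneg]
  refine Finset.sum_le_sum fun l _ => ?_
  rw [← Finset.sum_mul]
  exact mul_le_of_le_one_left (mul_nonneg (N.μ l).2 (hw l)) (N.P_row_sum_le_one l)

/-- Every fluid level process can be followed from any larger initial level by a larger process
whose distance to it never exceeds the initial distance. -/
theorem exists_ge_mem_fluidLevels {Q : Path K} (hQ : Q ∈ N.fluidLevels) {y : Orthant K}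
    (hy : Q 0 ≤ y) : ∃ R ∈ N.fluidLevels, R 0 = y ∧ (∀ t, Q t ≤ R t) ∧
      ∀ t, l1Dist (R t) (Q t) ≤ l1Dist y (Q 0) := by
  obtain ⟨T, hT⟩ := mem_fluidLevels.1 hQ
  set c : Fin J → ℝ≥0 → ℝ := N.residual (fun _ t => (t : ℝ)) T
  have hc : IsUnitRate c := isUnitRate_time.residual hT.mono hT.residual_mono
  -- The surplus network: no inflow, and as capacity the idle time of `T`.
  obtain ⟨E, W, hE0, hE⟩ := exists_allocation N 0 hc (y - Q 0)
  have hW : ∀ t k, 0 ≤ W t k := fun t k => (hE.alloc_le hc t k).1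
  have hR : ∀ j t, N.residual (fun _ t => (t : ℝ)) (T + W) j t = N.residual c W j t := by
    intro j t
    simp only [residual, c, Pi.add_apply, Matrix.mulVec_add]
    ring
  have h0 : Q 0 + E 0 = y := by
    rw [hE0]
    exact add_tsub_cancel_of_le hy
  have hd : ∀ t, l1Dist ((Q + E) t) (Q t) = l1 (E t) := by
    intro t
    rw [coe_l1]
    refine Finset.sum_congr rfl fun k _ => ?_
    simp only [Pi.add_apply, NNReal.coe_add, add_sub_cancel_left]
    exact abs_of_nonneg (E t k).2
  refine ⟨Q + E, mem_fluidLevels.2 ⟨T + W, ?_, ?_, ?_, ?_, ?_⟩, h0, fun t => ?_, fun t => ?_⟩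
  · intro t k
    simp only [Pi.add_apply, NNReal.coe_add, Matrix.mulVec_add]
    rw [hT.flow t, hE.flow t]
    simp only [Pi.zero_apply, NNReal.coe_zero]
    ring
  · simp [hT.zero, hE.zero]
  · exact hT.mono.add hE.mono
  · intro j
    simpa only [funext (hR j)] using hE.residual_mono j
  · intro j u hu
    simp only [hR]
    obtain ⟨k, hk, hpos⟩ := stationLevel_pos.1 hu
    rcases (add_pos_iff.1 hpos) with h | h
    -- If `Q` has fluid at the station, the idle capacity `c j` is locally constant. Then the
    -- surplus allocation and its residual, both monotone with constant sum, are constant too.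
    · filter_upwards [hT.conserving j u (stationLevel_pos.2 ⟨k, hk, h⟩)] with a ha
      have ha' : c j a = c j u := ha
      rcases le_total a u with hau | hau
      · have h1 := hE.residual_mono j hau
        have h2 := C_mulVec_mono (N := N) (hE.mono hau) j
        simp only [residual] at h1 ⊢
        linarith
      · have h1 := hE.residual_mono j hau
        have h2 := C_mulVec_mono (N := N) (hE.mono hau) j
        simp only [residual] at h1 ⊢
        linarith
    · exact hE.conserving j u (stationLevel_pos.2 ⟨k, hk, h⟩)
  · exact le_add_of_nonneg_right zero_le
  · have h1 : l1Dist y (Q 0) = l1 (E 0) := by rw [← hd 0, Pi.add_apply, h0]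
    rw [hd, h1, coe_l1, coe_l1, ← sub_nonneg, ← Finset.sum_sub_distrib]
    refine (sum_G_mulVec_nonneg (N := N) (hW t)).trans_eq (Finset.sum_congr rfl fun k _ => ?_)
    rw [hE.flow t]
    simp

theorem l1Dist_fluidLevels_le {Q : Path K} (hQ : Q ∈ N.fluidLevels) (t s : ℝ≥0) :
    l1Dist (Q t) (Q s) ≤ (N.rate N.α + 1) * |(t : ℝ) - s| := by
  obtain ⟨T, hT⟩ := mem_fluidLevels.1 hQ
  refine (hT.l1Dist_le isUnitRate_time t s).trans ?_
  gcongr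
  linarith

theorem continuous_of_mem_fluidLevels {Q : Path K} (hQ : Q ∈ N.fluidLevels) : Continuous Q := by
  obtain ⟨T, hT⟩ := mem_fluidLevels.1 hQ
  exact hT.continuous_path isUnitRate_time

/-- A factor `r ≤ 1` with `r • x ≤ y` that depends continuously on `y` near `x`. -/
noncomputable def shrink (x y : Orthant K) : ℝ≥0 := ∏ k, if x k = 0 then 1 else min 1 (y k / x k)

theorem shrink_smul_le (x y : Orthant K) : shrink x y • x ≤ y := by
  intro k
  rcases eq_or_ne (x k) 0 with h | h
  · simp [h]
  have h1 : shrink x y ≤ y k / x k := by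
    rw [shrink, ← Finset.mul_prod_erase _ _ (Finset.mem_univ k), if_neg h]
    refine (mul_le_of_le_one_right zero_le ?_).trans (min_le_right _ _)
    refine Finset.prod_le_one (fun _ _ => zero_le) fun l _ => ?_
    split_ifs
    exacts [le_rfl, min_le_left _ _]
  calc shrink x y * x k ≤ y k / x k * x k := by gcongr
    _ = y k := div_mul_cancel₀ _ h

/-- Coordinates where `x` vanishes impose no constraint and contribute the factor one; every other
factor is continuous with value one at `x`. -/
theorem tendsto_shrink (x : Orthant K) : Tendsto (shrink x) (𝓝 x) (𝓝 1) := by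
  have : Tendsto (shrink x) (𝓝 x) (𝓝 (∏ _k : Fin K, 1)) := by
    refine tendsto_finsetProd _ fun k _ => ?_
    by_cases h : x k = 0
    · simp [h]
    · simp only [h, if_false]
      have h1 : Tendsto (fun y : Orthant K => y k / x k) (𝓝 x) (𝓝 (x k / x k)) :=
        ((continuous_apply k).tendsto x).div_const _
      rw [div_self h] at h1
      simpa using (tendsto_const_nhds (x := (1 : ℝ≥0))).min h1
  simpa using this

/-- The two terms are the errors from rescaling space and from rescaling time; both vanish as `r →
1`. -/
theorem l1Dist_scale_le {Q : Path K} (hQ : Q ∈ N.fluidLevels) {r : ℝ≥0} (hr : 0 < r) {t : ℝ≥0}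
    (ht : t ≤ 1) : l1Dist (r • Q (r⁻¹ * t)) (Q t) ≤
      |(r : ℝ) - 1| * (l1 (Q 0) + (N.rate N.α + 1) * r⁻¹) +
        (N.rate N.α + 1) * |(r : ℝ)⁻¹ - 1| := by
  have hL : 0 ≤ N.rate N.α + 1 := by have := rate_nonneg (N := N) N.α; linarith
  refine (l1Dist_triangle _ (Q (r⁻¹ * t)) _).trans (add_le_add ?_ ?_)
  · rw [l1Dist_smul_left]
    gcongr
    have h1 := (abs_le.1 ((abs_l1_sub_le _ _).trans (l1Dist_fluidLevels_le hQ (r⁻¹ * t) 0))).2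
    have h2 : (N.rate N.α + 1) * |((r⁻¹ * t : ℝ≥0) : ℝ) - (0 : ℝ≥0)| ≤
        (N.rate N.α + 1) * (r : ℝ)⁻¹ := by
      gcongr
      rw [NNReal.coe_zero, sub_zero, abs_of_nonneg (NNReal.coe_nonneg _)]
      push_cast
      exact mul_le_of_le_one_right (by positivity) (by exact_mod_cast ht)
    push_cast at h1 h2 ⊢
    linarith
  · refine (l1Dist_fluidLevels_le hQ _ _).trans ?_
    refine mul_le_mul_of_nonneg_left ?_ hL
    have : ((r⁻¹ * t : ℝ≥0) : ℝ) - t = ((r : ℝ)⁻¹ - 1) * t := by push_cast; ring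
    rw [this, abs_mul, abs_of_nonneg (NNReal.coe_nonneg t)]
    exact mul_le_of_le_one_right (abs_nonneg _) (by exact_mod_cast ht)

theorem hasLSC_fluidLevels (N : Network K J) : HasLSC N.fluidLevels := by
  refine ⟨1, one_pos, ?_⟩
  rintro x y ⟨Q, ⟨hQ, rfl⟩, rfl⟩ xs - hxs
  set r : ℕ → ℝ≥0 := fun n => shrink (Q 0) (xs n)
  have hr : Tendsto r atTop (𝓝 1) := (tendsto_shrink (Q 0)).comp hxs
  have hex : ∀ n, ∃ R ∈ N.fluidLevels, R 0 = xs n ∧ (0 < r n → ∀ t,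
      l1Dist (R t) (r n • Q ((r n)⁻¹ * t)) ≤ l1Dist (xs n) (r n • Q 0)) := by
    intro n
    rcases eq_or_ne (r n) 0 with h | h
    -- Since `r n → 1`, this case occurs only finitely often and any path from `xs n` will do.
    · obtain ⟨R, hR, hR0⟩ := exists_mem_fluidLevels N (xs n)
      exact ⟨R, hR, hR0, fun h' => absurd h h'.ne'⟩
    · have hpos : 0 < (r n)⁻¹ := inv_pos.2 (pos_iff_ne_zero.2 h)
      have hmem := mem_fluidLevels_scale hQ hpos
      simp only [inv_inv] at hmem
      obtain ⟨R, hR, hR0, -, hd⟩ := exists_ge_mem_fluidLevels hmem (y := xs n)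
        (by simpa using shrink_smul_le (Q 0) (xs n))
      exact ⟨R, hR, hR0, fun _ t => by simpa using hd t⟩
  choose R hR hR0 hRd using hex
  refine ⟨fun n => restrictPath 1 (R n), fun n => ⟨R n, ⟨hR n, hR0 n⟩, rfl⟩, ?_⟩
  rw [UniformFun.tendsto_iff_tendstoUniformly, Metric.tendstoUniformly_iff]
  set b : ℕ → ℝ := fun n => l1Dist (xs n) (r n • Q 0) +
    (|(r n : ℝ) - 1| * (l1 (Q 0) + (N.rate N.α + 1) * (r n : ℝ)⁻¹) +
        (N.rate N.α + 1) * |(r n : ℝ)⁻¹ - 1|)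
  have hr' : Tendsto (fun n => (r n : ℝ)) atTop (𝓝 1) := by
    simpa using NNReal.tendsto_coe.2 hr
  have hri : Tendsto (fun n => (r n : ℝ)⁻¹) atTop (𝓝 1) := by
    simpa using hr'.inv₀ one_ne_zero
  have hb : Tendsto b atTop (𝓝 0) := by
    have h1 : Tendsto (fun n => l1Dist (xs n) (r n • Q 0)) atTop (𝓝 0) := by
      have h2 : Tendsto (fun n => r n • Q 0) atTop (𝓝 (Q 0)) := by
        simpa using hr.smul_const (Q 0)
      have := (continuous_l1Dist.tendsto (Q 0, Q 0)).comp (hxs.prodMk_nhds h2)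
      simpa [l1Dist_self, Function.comp_def] using this
    have h3 : Tendsto (fun n => |(r n : ℝ) - 1|) atTop (𝓝 0) := by
      simpa using (hr'.sub_const 1).abs
    have h4 : Tendsto (fun n => |(r n : ℝ)⁻¹ - 1|) atTop (𝓝 0) := by
      simpa using (hri.sub_const 1).abs
    simpa using h1.add ((h3.mul ((hri.const_mul (N.rate N.α + 1)).const_add (l1 (Q 0) : ℝ))).add
      (h4.const_mul (N.rate N.α + 1)))
  intro ε hε
  filter_upwards [hb.eventually_lt_const hε, hr.eventually_const_lt one_pos] with n hn hpos
  rintro ⟨t, -, ht⟩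
  refine lt_of_le_of_lt ?_ hn
  rw [dist_comm]
  refine (dist_le_l1Dist (R n t) (Q t)).trans ((l1Dist_triangle _ (r n • Q ((r n)⁻¹ * t)) _).trans
    (add_le_add (hRd n hpos t) ?_))
  exact l1Dist_scale_le hQ hpos ht

theorem isStrictGFN_fluidLevels (N : Network K J) : IsStrictGFN N.fluidLevels where
  nonempty := let ⟨Q, hQ, _⟩ := exists_mem_fluidLevels N 0; ⟨Q, hQ⟩
  lipschitz := ⟨N.rate N.α + 1, by have := rate_nonneg (N := N) N.α; linarith,
    fun _ hQ t s => l1Dist_fluidLevels_le hQ t s⟩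
  scaling _ hQ _ hr := mem_fluidLevels_scale hQ hr
  shift _ hQ s := mem_fluidLevels_shift hQ s
  closed Qs Q hQs hQ := by
    refine mem_fluidLevels_of_tendsto (Ultrafilter.of atTop) hQs fun t => ?_
    have h := (hQ (t + 1) (by positivity)).tendsto_at (x := t) ⟨zero_le, le_self_add⟩
    exact h.mono_left (Ultrafilter.of_le atTop)
  concatenation _ h₁ _ h₂ τ h := mem_fluidLevels_concat h₁ h₂ τ h
  lsc := hasLSC_fluidLevels N

theorem initialStates_fluidLevels (N : Network K J) :
    initialStates N.fluidLevels = Set.univ :=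
  Set.eq_univ_of_forall (exists_mem_fluidLevels N)


/-! ### From a Lyapunov function to stability -/

/-- Under a Lyapunov function the level is halved within a time proportional to it. -/
theorem exists_halving_time {V : Orthant K → ℝ≥0} (hV : IsLyapunov N.fluidLevels V) :
    ∃ τ : ℝ≥0, 0 < τ ∧ ∀ Q ∈ N.fluidLevels, ∀ r : ℝ≥0, 0 < r → l1 (Q 0) ≤ r →
      ∀ t, r * τ ≤ t → l1 (Q t) ≤ r / 2 := by
  obtain ⟨w₁, w₂, w₃, h₁, h₂, h₃, hb, hdec⟩ := hV
  have hb' : ∀ x, w₁ (l1 x) ≤ V x ∧ V x ≤ w₂ (l1 x) := fun x =>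
    hb x (by rw [initialStates_fluidLevels]; trivial)
  have hhalf : (0 : ℝ≥0) < 1 / 2 := by norm_num
  have hw1 : w₂ 0 < w₁ (1 / 2) := by
    rw [h₂.zero, ← h₁.zero]; exact h₁.strictMono hhalf
  -- Once the level has reached `δ`, the decrease of `V` keeps it below `1 / 2` forever.
  obtain ⟨δ, hδ, hδ0⟩ : ∃ δ : ℝ≥0, w₂ δ < w₁ (1 / 2) ∧ 0 < δ := by
    have e1 : ∀ᶠ δ in 𝓝[>] (0 : ℝ≥0), w₂ δ < w₁ (1 / 2) :=
      (h₂.continuous.continuousAt.eventually_lt_const hw1).filter_mono nhdsWithin_le_nhds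
    exact (e1.and self_mem_nhdsWithin).exists
  have hw3 : 0 < w₃ δ := by rw [← h₃.zero]; exact h₃.strictMono hδ0
  have hint : ∀ Q ∈ N.fluidLevels, ∀ a b : ℝ,
      IntervalIntegrable (fun r : ℝ => (w₃ (l1 (Q r.toNNReal)) : ℝ)) volume a b := by
    intro Q hQ a b
    refine Continuous.intervalIntegrable ?_ a b
    exact NNReal.continuous_coe.comp (h₃.continuous.comp (continuous_l1.comp
      ((continuous_of_mem_fluidLevels hQ).comp continuous_real_toNNReal)))
  -- If the level stayed above `δ` up to `τ`, `V` would lose at least `w₂ 1 + w₃ δ`, more than its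
  -- initial value; the summand `1` gives strictness.
  set τ : ℝ≥0 := w₂ 1 / w₃ δ + 1
  have hτ : 0 < τ := by positivity
  have hone : ∀ Q ∈ N.fluidLevels, l1 (Q 0) ≤ 1 → ∀ t, τ ≤ t → l1 (Q t) ≤ 1 / 2 := by
    intro Q hQ hQ0 t ht
    obtain ⟨s, hs, hsδ⟩ : ∃ s ≤ τ, l1 (Q s) ≤ δ := by
      by_contra! hcon
      have hd := hdec Q hQ 0 τ zero_le
      have h4 : ∫ _ in ((0 : ℝ≥0) : ℝ)..(τ : ℝ), (w₃ δ : ℝ) ≤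
          ∫ r in ((0 : ℝ≥0) : ℝ)..(τ : ℝ), (w₃ (l1 (Q r.toNNReal)) : ℝ) := by
        refine intervalIntegral.integral_mono_on (by simp) (by simp) (hint Q hQ _ _) ?_
        intro r hr
        refine NNReal.coe_le_coe.2 (h₃.strictMono.monotone (hcon _ ?_).le)
        exact Real.toNNReal_le_iff_le_coe.2 hr.2
      have h5 : (V (Q 0) : ℝ) ≤ w₂ 1 := NNReal.coe_le_coe.2
        ((hb' _).2.trans (h₂.strictMono.monotone hQ0))
      have h6 : (0 : ℝ) ≤ V (Q τ) := NNReal.coe_nonneg _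
      rw [intervalIntegral.integral_const, NNReal.coe_zero, sub_zero, smul_eq_mul] at h4
      have h7 : (τ : ℝ) * w₃ δ = w₂ 1 + w₃ δ := by
        have : (w₃ δ : ℝ) ≠ 0 := by exact_mod_cast hw3.ne'
        simp only [τ]
        push_cast
        field_simp
      have h8 : (0 : ℝ) < w₃ δ := by exact_mod_cast hw3
      rw [NNReal.coe_zero] at hd
      linarith
    have hst : s ≤ t := hs.trans ht
    have h4 : V (Q t) ≤ V (Q s) := by
      have hd := hdec Q hQ s t hst
      have : 0 ≤ ∫ r in (s : ℝ)..(t : ℝ), (w₃ (l1 (Q r.toNNReal)) : ℝ) :=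
        intervalIntegral.integral_nonneg (NNReal.coe_le_coe.2 hst) fun _ _ => NNReal.coe_nonneg _
      rw [← NNReal.coe_le_coe]
      linarith
    have h5 : w₁ (l1 (Q t)) < w₁ (1 / 2) := calc
      w₁ (l1 (Q t)) ≤ V (Q t) := (hb' _).1
      _ ≤ V (Q s) := h4
      _ ≤ w₂ (l1 (Q s)) := (hb' _).2
      _ ≤ w₂ δ := h₂.strictMono.monotone hsδ
      _ < w₁ (1 / 2) := hδ
    exact (h₁.strictMono.lt_iff_lt.1 h5).le
  refine ⟨τ, hτ, fun Q hQ r hr hQ0 t ht => ?_⟩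
  have h4 := hone _ (mem_fluidLevels_scale hQ hr)
    (by simpa [l1_smul] using (inv_mul_le_iff₀ hr).2 (by simpa using hQ0))
    (t / r) ((le_div_iff₀ hr).2 (by rwa [mul_comm]))
  simp only [l1_smul, mul_div_cancel₀ _ hr.ne'] at h4
  rw [inv_mul_le_iff₀ hr] at h4
  simpa [div_eq_mul_inv] using h4

/-- Successive halvings take times `r * τ`, `r * τ / 2`, and so on, so all of them are over by `2 *
r * τ`. -/
theorem isStable_of_isLyapunov {V : Orthant K → ℝ≥0} (hV : IsLyapunov N.fluidLevels V) :
    IsStable N.fluidLevels := by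
  obtain ⟨τ, hτ, hhalf⟩ := exists_halving_time hV
  have key : ∀ n : ℕ, ∀ Q ∈ N.fluidLevels, ∀ r : ℝ≥0, 0 < r → l1 (Q 0) ≤ r →
      ∀ t, 2 * r * τ ≤ t → l1 (Q t) ≤ r * (1 / 2) ^ n := by
    intro n
    induction n with
    | zero =>
      intro Q hQ r hr h0 t ht
      have h1 : r * τ ≤ t := le_trans (by gcongr; exact le_mul_of_one_le_left zero_le one_le_two) ht
      simpa using (hhalf Q hQ r hr h0 t h1).trans (half_le_self zero_le)
    | succ n ih =>
      intro Q hQ r hr h0 t ht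
      have h1 : r * τ ≤ t := le_trans (by gcongr; exact le_mul_of_one_le_left zero_le one_le_two) ht
      have h2 := ih _ (mem_fluidLevels_shift hQ (r * τ)) (r / 2) (half_pos hr)
        (by simpa using hhalf Q hQ r hr h0 _ le_rfl) (t - r * τ) (by
          rw [le_tsub_iff_right h1]
          refine le_trans (le_of_eq ?_) ht
          rw [mul_div_cancel₀ _ two_ne_zero]
          ring)
      rw [add_tsub_cancel_of_le h1] at h2
      refine h2.trans_eq ?_
      rw [pow_succ]
      ring
  refine ⟨2 * τ, by positivity, fun Q hQ h1 t => eq_zero_of_l1 (le_antisymm ?_ zero_le)⟩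
  have hlim : Tendsto (fun n : ℕ => (1 : ℝ≥0) * (1 / 2) ^ n) atTop (𝓝 (1 * 0)) :=
    (NNReal.tendsto_pow_atTop_nhds_zero_of_lt_one (by
      rw [div_lt_one two_pos]; exact one_lt_two)).const_mul 1
  rw [mul_zero] at hlim
  exact ge_of_tendsto' hlim fun n => key n Q hQ 1 one_pos h1.le _ (by simp)

/-! ### From stability to a continuous Lyapunov function -/

/-- In a stable network every path vanishes after a time proportional to its initial level. -/
theorem exists_extinction_time (h : IsStable N.fluidLevels) : ∃ τ : ℝ≥0, 0 < τ ∧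
    ∀ Q ∈ N.fluidLevels, ∀ t, l1 (Q 0) * τ ≤ t → Q t = 0 := by
  obtain ⟨τ, hτ, hst⟩ := h
  refine ⟨τ, hτ, fun Q hQ t ht => ?_⟩
  rcases eq_or_ne (l1 (Q 0)) 0 with h0 | h0
  -- Stability speaks only of initial level one, so scaling does not reach the origin. Instead, the
  -- path is appended to one from a unit vector, which is at zero at time `τ`.
  · ext k
    have hk : l1 (Pi.single k 1 : Orthant K) = 1 := by simp [l1]
    obtain ⟨R, hR, hR0⟩ := exists_mem_fluidLevels N (Pi.single k 1)
    have hRτ : R τ = Q 0 := by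
      rw [eq_zero_of_l1 h0]
      simpa using hst R hR (by rw [hR0, hk]) 0
    have := hst _ (mem_fluidLevels_concat hR hQ τ hRτ) (by simp [concat, hR0, hk]) t
    rw [concat] at this
    split_ifs at this with hle
    · have ht0 : t = 0 := by simpa using hle
      rw [ht0, eq_zero_of_l1 h0]
    · rw [add_tsub_cancel_left] at this
      rw [this]
  · have hpos : 0 < l1 (Q 0) := pos_iff_ne_zero.2 h0
    have := hst _ (mem_fluidLevels_scale hQ hpos) (by simp [l1_smul, h0])
      (t / l1 (Q 0) - τ)
    rw [add_tsub_cancel_of_le ((le_div_iff₀ hpos).2 (by rwa [mul_comm])),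
      mul_div_cancel₀ _ h0] at this
    simpa [h0] using this

/-- The total content `∫₀^∞ ‖Q(t)‖ dt` of a path. -/
noncomputable def content (Q : Path K) : ℝ≥0∞ :=
  ∫⁻ t in Set.Ioi (0 : ℝ), (l1 (Q t.toNNReal) : ℝ≥0∞)

theorem content_mono {Q R : Path K} (h : ∀ t, Q t ≤ R t) : content Q ≤ content R :=
  lintegral_mono fun _ => ENNReal.coe_le_coe.2 (l1_mono (h _))

/-- One factor `r` comes from the levels, the other from the stretched time. -/
theorem content_scale (Q : Path K) {r : ℝ≥0} (hr : 0 < r) :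
    content (fun t => r • Q (r⁻¹ * t)) = r ^ 2 * content Q := by
  have hr' : (0 : ℝ) < r := by exact_mod_cast hr
  have himg : (fun t : ℝ => r * t) '' Set.Ioi 0 = Set.Ioi 0 := by
    rw [Set.image_mul_left_Ioi hr', mul_zero]
  have h := lintegral_image_eq_lintegral_abs_deriv_mul (s := Set.Ioi (0 : ℝ))
    (f := fun t : ℝ => r * t) (f' := fun _ => r) measurableSet_Ioi
    (fun x _ => by simpa using ((hasDerivAt_id x).const_mul (r : ℝ)).hasDerivWithinAt)
    (fun x _ y _ hxy => mul_left_cancel₀ hr'.ne' hxy)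
    (fun t => (l1 (r • Q (r⁻¹ * t.toNNReal)) : ℝ≥0∞))
  rw [himg] at h
  rw [content, h, content, ← lintegral_const_mul' _ _ (by simp)]
  refine lintegral_congr fun t => ?_
  rw [Real.toNNReal_mul hr'.le, Real.toNNReal_coe, inv_mul_cancel_left₀ hr.ne', l1_smul,
    abs_of_pos hr', ENNReal.ofReal_coe_nnreal]
  push_cast
  ring

theorem content_concat {Q : Path K} (R : Path K) (s : ℝ≥0) :
    content (concat Q s R) =
      (∫⁻ t in Set.Ioc (0 : ℝ) s, (l1 (Q t.toNNReal) : ℝ≥0∞)) + content R := by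
  have hU : Set.Ioi (0 : ℝ) = Set.Ioc 0 (s : ℝ) ∪ Set.Ioi (s : ℝ) :=
    (Set.Ioc_union_Ioi_eq_Ioi s.2).symm
  have himg : (fun t : ℝ => t + s) '' Set.Ioi 0 = Set.Ioi (s : ℝ) := by
    simp
  have h := lintegral_image_eq_lintegral_abs_deriv_mul (s := Set.Ioi (0 : ℝ))
    (f := fun t : ℝ => t + s) (f' := fun _ => 1) measurableSet_Ioi
    (fun x _ => by simpa using ((hasDerivAt_id x).add_const (s : ℝ)).hasDerivWithinAt)
    (fun x _ y _ hxy => add_right_cancel hxy)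
    (fun t => (l1 (concat Q s R t.toNNReal) : ℝ≥0∞))
  rw [content, hU, lintegral_union measurableSet_Ioi (Set.Ioc_disjoint_Ioi le_rfl)]
  congr 1
  · refine setLIntegral_congr_fun measurableSet_Ioc fun t ht => ?_
    have : t.toNNReal ≤ s := Real.toNNReal_le_iff_le_coe.2 ht.2
    simp only [concat, if_pos this]
  · rw [← himg, h, content]
    refine setLIntegral_congr_fun measurableSet_Ioi fun t ht => ?_
    have h1 : (t + s).toNNReal = t.toNNReal + s := by
      rw [Real.toNNReal_add (le_of_lt ht) (NNReal.coe_nonneg s), Real.toNNReal_coe]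
    have h2 : ¬ t.toNNReal + s ≤ s := by
      have : 0 < t.toNNReal := Real.toNNReal_pos.2 ht
      simpa using this
    simp only [concat, h1, if_neg h2, add_tsub_cancel_right, abs_one, ENNReal.ofReal_one, one_mul]

theorem content_eq_of_vanish {Q : Path K} {R : ℝ≥0} (h : ∀ t, R ≤ t → Q t = 0) :
    content Q = ∫⁻ t in Set.Ioc (0 : ℝ) R, (l1 (Q t.toNNReal) : ℝ≥0∞) := by
  have hU : Set.Ioi (0 : ℝ) = Set.Ioc 0 (R : ℝ) ∪ Set.Ioi (R : ℝ) :=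
    (Set.Ioc_union_Ioi_eq_Ioi R.2).symm
  have h0 : ∫⁻ t in Set.Ioi (R : ℝ), (l1 (Q t.toNNReal) : ℝ≥0∞) = 0 := by
    rw [setLIntegral_congr_fun (g := fun _ => 0) measurableSet_Ioi fun t ht => ?_]
    · simp
    · have : R ≤ t.toNNReal := NNReal.le_toNNReal_of_coe_le (le_of_lt ht)
      simp [h _ this, l1]
  rw [content, hU, lintegral_union measurableSet_Ioi (Set.Ioc_disjoint_Ioi le_rfl), h0, add_zero]

theorem lintegral_Ioc_le {Q : Path K} {R b : ℝ≥0} (h : ∀ t ≤ R, l1 (Q t) ≤ b) :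
    ∫⁻ t in Set.Ioc (0 : ℝ) R, (l1 (Q t.toNNReal) : ℝ≥0∞) ≤ b * R := by
  calc _ ≤ ∫⁻ _ in Set.Ioc (0 : ℝ) R, (b : ℝ≥0∞) := setLIntegral_mono' measurableSet_Ioc
        fun t ht => ENNReal.coe_le_coe.2 (h _ (Real.toNNReal_le_iff_le_coe.2 ht.2))
    _ = b * R := by rw [setLIntegral_const, Real.volume_Ioc, sub_zero, ENNReal.ofReal_coe_nnreal]

theorem le_lintegral_Ioc {Q : Path K} {R b : ℝ≥0} (h : ∀ t ≤ R, b ≤ l1 (Q t)) :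
    b * R ≤ ∫⁻ t in Set.Ioc (0 : ℝ) R, (l1 (Q t.toNNReal) : ℝ≥0∞) := by
  calc (b * R : ℝ≥0∞) = ∫⁻ _ in Set.Ioc (0 : ℝ) R, (b : ℝ≥0∞) := by
        rw [setLIntegral_const, Real.volume_Ioc, sub_zero, ENNReal.ofReal_coe_nnreal]
    _ ≤ _ := setLIntegral_mono' measurableSet_Ioc
        fun t ht => ENNReal.coe_le_coe.2 (h _ (Real.toNNReal_le_iff_le_coe.2 ht.2))

/-- A positive Lipschitz constant of all fluid level processes. -/
noncomputable def lip (N : Network K J) : ℝ≥0 := ⟨N.rate N.α + 1, by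
  have := rate_nonneg (N := N) N.α; linarith⟩

theorem lip_pos (N : Network K J) : 0 < N.lip := by
  have := rate_nonneg (N := N) N.α
  rw [← NNReal.coe_pos]
  show 0 < N.rate N.α + 1
  linarith

theorem abs_l1_fluidLevels_le {Q : Path K} (hQ : Q ∈ N.fluidLevels) (t s : ℝ≥0) :
    |(l1 (Q t) : ℝ) - l1 (Q s)| ≤ N.lip * |(t : ℝ) - s| :=
  (abs_l1_sub_le _ _).trans (l1Dist_fluidLevels_le hQ t s)

theorem l1_le {Q : Path K} (hQ : Q ∈ N.fluidLevels) (t : ℝ≥0) :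
    l1 (Q t) ≤ l1 (Q 0) + N.lip * t := by
  have := (abs_le.1 (abs_l1_fluidLevels_le hQ t 0)).2
  rw [NNReal.coe_zero, sub_zero, abs_of_nonneg (NNReal.coe_nonneg t)] at this
  rw [← NNReal.coe_le_coe]
  push_cast
  linarith

theorem le_l1 {Q : Path K} (hQ : Q ∈ N.fluidLevels) (t : ℝ≥0) :
    l1 (Q 0) ≤ l1 (Q t) + N.lip * t := by
  have := (abs_le.1 (abs_l1_fluidLevels_le hQ t 0)).1
  rw [NNReal.coe_zero, sub_zero, abs_of_nonneg (NNReal.coe_nonneg t)] at this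
  rw [← NNReal.coe_le_coe]
  push_cast
  linarith

/-- The largest total content of the paths starting at a given point. -/
noncomputable def maxContent (N : Network K J) (x : Orthant K) : ℝ≥0∞ :=
  ⨆ Q ∈ pathsFrom N.fluidLevels x, content Q

theorem content_le_maxContent {Q : Path K} (hQ : Q ∈ N.fluidLevels) :
    content Q ≤ N.maxContent (Q 0) :=
  le_iSup₂_of_le Q ⟨hQ, rfl⟩ le_rfl

/-- By the Lipschitz bound the level stays above half its initial value for a time `l1 x / (2 *
N.lip)`; the bound is the area of this rectangle. -/
theorem le_maxContent (N : Network K J) (x : Orthant K) :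
    ((l1 x ^ 2 / (4 * N.lip) : ℝ≥0) : ℝ≥0∞) ≤ N.maxContent x := by
  obtain ⟨Q, hQ, rfl⟩ := exists_mem_fluidLevels N x
  refine le_trans ?_ (content_le_maxContent hQ)
  have hL := (lip_pos N).ne'
  have h1 : ∀ t ≤ l1 (Q 0) / (2 * N.lip), l1 (Q 0) / 2 ≤ l1 (Q t) := by
    intro t ht
    have h2 := le_l1 hQ t
    have h3 : N.lip * t ≤ l1 (Q 0) / 2 := calc
      N.lip * t ≤ N.lip * (l1 (Q 0) / (2 * N.lip)) := by gcongr
      _ = l1 (Q 0) / 2 := by field_simp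
    have h4 : l1 (Q 0) / 2 + l1 (Q 0) / 2 ≤ l1 (Q t) + l1 (Q 0) / 2 := by
      rw [add_halves]; exact h2.trans (by gcongr)
    exact le_of_add_le_add_right h4
  calc ((l1 (Q 0) ^ 2 / (4 * N.lip) : ℝ≥0) : ℝ≥0∞)
      = ((l1 (Q 0) / 2 : ℝ≥0) : ℝ≥0∞) * ((l1 (Q 0) / (2 * N.lip) : ℝ≥0) : ℝ≥0∞) := by
        rw [← ENNReal.coe_mul]; congr 1; field_simp; norm_num
    _ ≤ _ := le_lintegral_Ioc h1
    _ ≤ content Q := lintegral_mono_set Set.Ioc_subset_Ioi_self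

theorem maxContent_le {τ : ℝ≥0}
    (hτ : ∀ Q ∈ N.fluidLevels, ∀ t, l1 (Q 0) * τ ≤ t → Q t = 0) (x : Orthant K) :
    N.maxContent x ≤ (((1 + N.lip * τ) * τ * l1 x ^ 2 : ℝ≥0) : ℝ≥0∞) := by
  refine iSup₂_le fun Q hQ => ?_
  obtain ⟨hQ, rfl⟩ := hQ
  rw [content_eq_of_vanish (hτ Q hQ)]
  refine (lintegral_Ioc_le (b := l1 (Q 0) + N.lip * (l1 (Q 0) * τ)) fun t ht => ?_).trans_eq ?_
  · exact (l1_le hQ t).trans (by gcongr)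
  · rw [← ENNReal.coe_mul]; congr 1; ring

/-- The content along a path is an upper bound for the decrease of `maxContent`. -/
theorem lintegral_add_maxContent_le {Q : Path K} (hQ : Q ∈ N.fluidLevels) (s : ℝ≥0) :
    (∫⁻ t in Set.Ioc (0 : ℝ) s, (l1 (Q t.toNNReal) : ℝ≥0∞)) + N.maxContent (Q s) ≤
      N.maxContent (Q 0) := by
  obtain ⟨R₀, hR₀, hR₀0⟩ := exists_mem_fluidLevels N (Q s)
  rw [maxContent, ENNReal.add_biSup' ⟨R₀, hR₀, hR₀0⟩]
  refine iSup₂_le fun R hR => ?_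
  -- Following `Q` up to `s` and then `R` is a competitor in the supremum at `Q 0`.
  rw [← content_concat]
  have := content_le_maxContent (mem_fluidLevels_concat hQ hR.1 s hR.2.symm)
  simpa [concat] using this

/-- Lower semicontinuity of `maxContent`. -/
theorem eventually_lt_maxContent (x : Orthant K) {c : ℝ≥0∞} (hc : c < N.maxContent x) :
    ∀ᶠ y in 𝓝 x, c < N.maxContent y := by
  obtain ⟨Q, ⟨hQ, rfl⟩, hcQ⟩ : ∃ Q ∈ pathsFrom N.fluidLevels x, c < content Q := by
    simpa [maxContent, lt_iSup_iff] using hc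
  have hlim : Tendsto (fun y => ((shrink (Q 0) y : ℝ≥0) : ℝ≥0∞) ^ 2 * content Q) (𝓝 (Q 0))
      (𝓝 (content Q)) := by
    have h1 : Tendsto (fun y => ((shrink (Q 0) y : ℝ≥0) : ℝ≥0∞) ^ 2) (𝓝 (Q 0)) (𝓝 1) := by
      simpa [Function.comp_def] using ((ENNReal.continuous_pow 2).tendsto _).comp
        (ENNReal.tendsto_coe.2 (tendsto_shrink (Q 0)))
    simpa using ENNReal.Tendsto.mul_const h1 (Or.inl one_ne_zero)
  filter_upwards [hlim.eventually_const_lt hcQ,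
    (tendsto_shrink (Q 0)).eventually_const_lt one_pos] with y hy hpos
  refine hy.trans_le ?_
  have hmem := mem_fluidLevels_scale hQ (inv_pos.2 hpos)
  simp only [inv_inv] at hmem
  -- A nearly optimal path from `x`, shrunk to start below `y`, is dominated by a path from `y`.
  obtain ⟨R, hR, rfl, hge, -⟩ := exists_ge_mem_fluidLevels hmem (y := y)
    (by simpa using shrink_smul_le (Q 0) y)
  rw [← content_scale Q hpos]
  exact (content_mono hge).trans (content_le_maxContent hR)

/-- Compactness of the set of fluid level processes with convergent initial levels. -/
theorem exists_tendsto_fluidLevels {ι : Type*} (U : Ultrafilter ι) {Qs : ι → Path K}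
    {x : Orthant K} (hQs : ∀ i, Qs i ∈ N.fluidLevels)
    (hx : Tendsto (fun i => Qs i 0) U (𝓝 x)) :
    ∃ Q ∈ N.fluidLevels, Q 0 = x ∧ ∀ t, Tendsto (fun i => Qs i t) U (𝓝 (Q t)) := by
  have hbd : ∀ᶠ i in (U : Filter ι), l1 (Qs i 0) < l1 x + 1 :=
    ((continuous_l1.tendsto x).comp hx).eventually_lt_const (lt_add_one _)
  obtain ⟨g, hg⟩ := exists_tendsto_pi_of_bounded U
    (f := fun i (p : ℝ≥0 × Fin K) => (Qs i p.1 p.2 : ℝ)) (fun _ => 0)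
    (fun p => ((l1 x + 1 + N.lip * p.1 : ℝ≥0) : ℝ)) (by
      filter_upwards [hbd] with i hi p
      refine ⟨NNReal.coe_nonneg _, NNReal.coe_le_coe.2 ?_⟩
      calc Qs i p.1 p.2 ≤ l1 (Qs i p.1) :=
            Finset.single_le_sum (f := fun k => Qs i p.1 k) (fun _ _ => zero_le)
              (Finset.mem_univ p.2)
        _ ≤ l1 (Qs i 0) + N.lip * p.1 := l1_le (hQs i) p.1
        _ ≤ _ := by gcongr)
  have hk : ∀ t k, Tendsto (fun i => (Qs i t k : ℝ)) U (𝓝 (g (t, k))) := fun t k =>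
    tendsto_pi_nhds.1 hg (t, k)
  have hlim : ∀ t, Tendsto (fun i => Qs i t) U (𝓝 fun k => (g (t, k)).toNNReal) := by
    intro t
    refine tendsto_pi_nhds.2 fun k => NNReal.tendsto_coe.1 ?_
    rw [Real.coe_toNNReal _ (ge_of_tendsto' (hk t k) fun i => NNReal.coe_nonneg _)]
    exact hk t k
  exact ⟨fun t k => (g (t, k)).toNNReal, mem_fluidLevels_of_tendsto U hQs hlim,
    tendsto_nhds_unique (hlim 0) hx, hlim⟩

/-- Upper semicontinuity of `maxContent`. -/
theorem eventually_maxContent_lt {τ : ℝ≥0}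
    (hτ : ∀ Q ∈ N.fluidLevels, ∀ t, l1 (Q 0) * τ ≤ t → Q t = 0) (x : Orthant K) {c : ℝ≥0∞}
    (hc : N.maxContent x < c) : ∀ᶠ y in 𝓝 x, N.maxContent y < c := by
  -- The gap yields single paths of content above `c'` even where the supremum is not known to be
  -- attained.
  obtain ⟨c', hc', hcc'⟩ := exists_between hc
  by_contra hcon
  have hfreq : ∃ᶠ y in 𝓝 x, c ≤ N.maxContent y := fun h => hcon (by
    filter_upwards [h] with y hy
    exact not_le.1 hy)
  have hex : ∀ y, ∃ Q ∈ N.fluidLevels, Q 0 = y ∧ (c ≤ N.maxContent y → c' < content Q) := by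
    intro y
    by_cases hy : c ≤ N.maxContent y
    · have := hcc'.trans_le hy
      obtain ⟨Q, ⟨hQ, hQ0⟩, h⟩ : ∃ Q ∈ pathsFrom N.fluidLevels y, c' < content Q := by
        simpa [maxContent, lt_iSup_iff] using this
      exact ⟨Q, hQ, hQ0, fun _ => h⟩
    · obtain ⟨Q, hQ, hQ0⟩ := exists_mem_fluidLevels N y
      exact ⟨Q, hQ, hQ0, fun h => absurd h hy⟩
  choose Qs hQs hQs0 hQsc using hex
  have hne : (𝓝 x ⊓ 𝓟 {y | c ≤ N.maxContent y}).NeBot :=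
    frequently_mem_iff_neBot.1 hfreq
  set U := Ultrafilter.of (𝓝 x ⊓ 𝓟 {y | c ≤ N.maxContent y})
  have hU : (U : Filter (Orthant K)) ≤ 𝓝 x ⊓ 𝓟 {y | c ≤ N.maxContent y} := Ultrafilter.of_le _
  have hUx : (U : Filter (Orthant K)) ≤ 𝓝 x := hU.trans inf_le_left
  have hUc : ∀ᶠ y in (U : Filter (Orthant K)), c ≤ N.maxContent y :=
    (hU.trans inf_le_right) (mem_principal_self _)
  obtain ⟨Q, hQ, hQ0, hlim⟩ := exists_tendsto_fluidLevels U hQs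
    (x := x) (by simp only [hQs0]; exact tendsto_id'.2 hUx)
  set R : ℝ≥0 := (l1 x + 1) * τ
  have hvan : ∀ᶠ y in (U : Filter (Orthant K)), ∀ t, R ≤ t → Qs y t = 0 := by
    have h1 : ∀ᶠ y in 𝓝 x, l1 y < l1 x + 1 :=
      (continuous_l1.tendsto x).eventually_lt_const (lt_add_one _)
    filter_upwards [hUx h1] with y hy t ht
    have hy' : l1 y < l1 x + 1 := hy
    refine hτ _ (hQs y) t (le_trans ?_ ht)
    rw [hQs0]
    exact mul_le_mul_of_nonneg_right hy'.le zero_le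
  have hvanQ : ∀ t, R ≤ t → Q t = 0 := fun t ht => hτ Q hQ t (le_trans (by
    rw [hQ0]; exact mul_le_mul_of_nonneg_right le_self_add zero_le) ht)
  have hQc : content Q < c' := (content_le_maxContent hQ).trans_lt (by rwa [hQ0])
  obtain ⟨δ, hδ, hδc⟩ := ENNReal.lt_iff_exists_add_pos_lt.1 hQc
  -- Equicontinuity upgrades pointwise to uniform convergence up to the common extinction time `R`,
  -- so the contents can be compared.
  have hequi : Equicontinuous fun (y : Orthant K) (t : Set.Icc (0 : ℝ≥0) R) =>
      (l1 (Qs y t) : ℝ) := by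
    refine (LipschitzWith.uniformEquicontinuous _ N.lip fun y => ?_).equicontinuous
    refine LipschitzWith.of_dist_le_mul fun a b => ?_
    exact abs_l1_fluidLevels_le (hQs y) a b
  have hunif := (hequi.tendsto_uniformFun_iff_pi U
    (fun t : Set.Icc (0 : ℝ≥0) R => (l1 (Q t) : ℝ))).2 (tendsto_pi_nhds.2 fun t =>
      NNReal.tendsto_coe.2 ((continuous_l1.tendsto _).comp (hlim t)))
  rw [UniformFun.tendsto_iff_tendstoUniformly, Metric.tendstoUniformly_iff] at hunif
  -- Integrated over a time `R`, this error costs at most `δ`.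
  have hε : (0 : ℝ) < δ / (R + 1) := by positivity
  obtain ⟨y, h1, h2, h3⟩ := ((hunif _ hε).and (hvan.and hUc)).exists
  refine absurd (hQsc y h3) (not_lt.2 (le_trans ?_ hδc.le))
  rw [content_eq_of_vanish h2, content_eq_of_vanish hvanQ]
  have hpt : ∀ t ∈ Set.Ioc (0 : ℝ) R, (l1 (Qs y t.toNNReal) : ℝ≥0∞) ≤
      (l1 (Q t.toNNReal) : ℝ≥0∞) + (δ / (R + 1) : ℝ≥0) := by
    intro t ht
    rw [← ENNReal.coe_add, ENNReal.coe_le_coe, ← NNReal.coe_le_coe]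
    have := h1 ⟨t.toNNReal, zero_le, Real.toNNReal_le_iff_le_coe.2 ht.2⟩
    rw [Real.dist_eq, abs_lt] at this
    have h4 := this.1
    simp only [Function.comp, UniformFun.toFun_ofFun] at h4
    push_cast
    linarith
  calc _ ≤ ∫⁻ t in Set.Ioc (0 : ℝ) R, ((l1 (Q t.toNNReal) : ℝ≥0∞) + (δ / (R + 1) : ℝ≥0)) :=
        setLIntegral_mono' measurableSet_Ioc hpt
    _ = (∫⁻ t in Set.Ioc (0 : ℝ) R, (l1 (Q t.toNNReal) : ℝ≥0∞)) + (δ / (R + 1) : ℝ≥0) * R := by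
        rw [lintegral_add_right _ measurable_const, setLIntegral_const, Real.volume_Ioc, sub_zero,
          ENNReal.ofReal_coe_nnreal]
    _ ≤ _ := by
        refine add_le_add_right ?_ _
        rw [← ENNReal.coe_mul, ENNReal.coe_le_coe, div_mul_eq_mul_div]
        refine NNReal.div_le_of_le_mul ?_
        gcongr
        exact le_self_add

theorem isClassK_mul_sq {a : ℝ≥0} (ha : 0 < a) : IsClassK fun r => a * r ^ 2 where
  continuous := by fun_prop
  strictMono x y hxy := mul_lt_mul_of_pos_left (pow_lt_pow_left₀ hxy zero_le two_ne_zero) ha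
  zero := by simp

/-- The converse Lyapunov theorem: `maxContent` is a continuous Lyapunov function. -/
theorem exists_continuous_isLyapunov (h : IsStable N.fluidLevels) :
    ∃ V : Orthant K → ℝ≥0, IsLyapunov N.fluidLevels V ∧ Continuous V := by
  obtain ⟨τ, hτ0, hτ⟩ := exists_extinction_time h
  have hfin : ∀ x, N.maxContent x ≠ ∞ := fun x =>
    ((maxContent_le hτ x).trans_lt ENNReal.coe_lt_top).ne
  refine ⟨fun x => (N.maxContent x).toNNReal, ?_, ?_⟩
  · refine ⟨fun r => (4 * N.lip)⁻¹ * r ^ 2, fun r => (1 + N.lip * τ) * τ * r ^ 2, id,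
      isClassK_mul_sq (by have := lip_pos N; positivity), isClassK_mul_sq (by positivity),
      ⟨continuous_id, strictMono_id, rfl⟩, fun x _ => ⟨?_, ?_⟩, fun Q hQ s t hst => ?_⟩
    · rw [← ENNReal.coe_le_coe, ENNReal.coe_toNNReal (hfin x)]
      simp only [inv_mul_eq_div]
      exact le_maxContent N x
    · rw [← ENNReal.coe_le_coe, ENNReal.coe_toNNReal (hfin x)]
      exact maxContent_le hτ x
    · have hd := lintegral_add_maxContent_le (mem_fluidLevels_shift hQ s) (t - s)
      simp only [add_tsub_cancel_of_le hst, add_zero] at hd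
      have hcont : Continuous fun r : ℝ => (l1 (Q (s + r.toNNReal)) : ℝ) :=
        NNReal.continuous_coe.comp (continuous_l1.comp ((continuous_of_mem_fluidLevels hQ).comp
          (continuous_const.add continuous_real_toNNReal)))
      have hts : (0 : ℝ) ≤ t - s := sub_nonneg.2 (NNReal.coe_le_coe.2 hst)
      have hI : ∫ r in (s : ℝ)..(t : ℝ), (l1 (Q r.toNNReal) : ℝ) =
          ∫ r in (0 : ℝ)..((t - s : ℝ≥0) : ℝ), (l1 (Q (s + r.toNNReal)) : ℝ) := by
        have h1 := intervalIntegral.integral_comp_add_left (a := 0) (b := (t : ℝ) - s)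
          (fun r : ℝ => (l1 (Q r.toNNReal) : ℝ)) (s : ℝ)
        rw [add_zero, add_sub_cancel] at h1
        rw [← h1, NNReal.coe_sub hst]
        refine intervalIntegral.integral_congr fun r hr => ?_
        rw [Set.uIcc_of_le hts] at hr
        rw [Real.toNNReal_add (NNReal.coe_nonneg s) hr.1, Real.toNNReal_coe]
      have hE : ∫⁻ r in Set.Ioc (0 : ℝ) ((t - s : ℝ≥0) : ℝ),
          (l1 (Q (s + r.toNNReal)) : ℝ≥0∞) = ENNReal.ofReal
            (∫ r in (0 : ℝ)..((t - s : ℝ≥0) : ℝ), (l1 (Q (s + r.toNNReal)) : ℝ)) := by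
        rw [intervalIntegral.integral_of_le (NNReal.coe_nonneg _),
          ofReal_integral_eq_lintegral_ofReal]
        · simp only [ENNReal.ofReal_coe_nnreal]
        · exact (hcont.integrableOn_Icc).mono_set Set.Ioc_subset_Icc_self
        · exact Eventually.of_forall fun r => NNReal.coe_nonneg _
      have hI0 : 0 ≤ ∫ r in (0 : ℝ)..((t - s : ℝ≥0) : ℝ), (l1 (Q (s + r.toNNReal)) : ℝ) :=
        intervalIntegral.integral_nonneg (NNReal.coe_nonneg _) fun _ _ => NNReal.coe_nonneg _
      rw [hE] at hd
      have hd' := ENNReal.toReal_mono (hfin _) hd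
      rw [ENNReal.toReal_add ENNReal.ofReal_ne_top (hfin _), ENNReal.toReal_ofReal hI0,
        ← hI] at hd'
      show (N.maxContent (Q t)).toReal - (N.maxContent (Q s)).toReal ≤
        -∫ r in (s : ℝ)..(t : ℝ), (l1 (Q r.toNNReal) : ℝ)
      linarith
  · rw [continuous_iff_continuousAt]
    intro x
    have : ContinuousAt N.maxContent x :=
      tendsto_order.2 ⟨fun c hc => eventually_lt_maxContent x hc,
        fun c hc => eventually_maxContent_lt hτ x hc⟩
    exact (ENNReal.tendsto_toNNReal (hfin x)).comp this

end Network
end FluidNet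

theorem mainTheorem5 {K J : ℕ} (N : FluidNet.Network K J) :
    FluidNet.IsStrictGFN N.fluidLevels ∧
    FluidNet.initialStates N.fluidLevels = Set.univ ∧
    (FluidNet.IsStable N.fluidLevels ↔
      ∃ V : FluidNet.Orthant K → NNReal,
        FluidNet.IsLyapunov N.fluidLevels V ∧
        ContinuousOn V (FluidNet.initialStates N.fluidLevels)) := by
  refine ⟨N.isStrictGFN_fluidLevels, N.initialStates_fluidLevels, ?_⟩
  constructor
  · intro h
    obtain ⟨V, hV, hc⟩ := FluidNet.Network.exists_continuous_isLyapunov h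
    exact ⟨V, hV, hc.continuousOn⟩
  · rintro ⟨V, hV, -⟩
    exact FluidNet.Network.isStable_of_isLyapunov hV
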